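/- Let $A,B$ be integers with $4A^3+27B^2\neq 0$, and let $E$ be the elliptic curve $Y^2=X^3+AX+B$ over $\mathbb{Q}$. Consider systems of the form $$P(z)=6^2A,\qquad Q(z)=6^3B,\qquad R(z)=0,\qquad S(z)=0,$$ with the following polynomials in $\mathbb{Z}[z_1,z_2,z_3,z_4]$ (a polynomial $R$ or $S$ that is not listed is $0$). * $\Sigma_3$: $P_3=6^2(27z_1^4+6z_1z_2)$, $\;Q_3=6^3(z_2^2-27z_1^6)$. * $\Sigma_4$: $P_4=6^2(-3z_1^2+6z_1z_2^2-2z_2^4)$, $\;Q_4=6^3(2z_1-z_2^2)(z_1^2+2z_1z_2^2-z_2^4)$. * $\Sigma_5$: $P_5=18\left[(z_1-z_2)^2-6z_1^2+(z_1-z_2)z_3^2\right]$, $\;Q_5=54(z_1+z_2)\left[6z_1^2-2z_1z_2+(z_2-z_1)z_3^2\right]$, $\;R_5=z_3^4-6z_3^2(z_1+z_2)+(z_1-z_2)^2$. * $\Sigma_7$: $P_7=-6^2\left[(z_1+z_2)^2-z_1z_2+z_4(z_2-z_1)\right]$, $\;Q_7=54\left[z_3^2(z_1-z_2)^2+4z_1(z_2^2+z_1z_2+z_2z_4-z_1z_4)\right]$,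 $\;R_7=(2z_1+z_2+z_4)^2-z_3^2(2z_1+z_2)$, $\;S_7=-z_3^4+(5z_1+z_2+6z_4)z_3^2+(-3z_1^2+3z_2^2-8z_4^2-18z_1z_4-6z_2z_4)$. * $\Sigma_8$: $P_8=-12(z_1^4-4z_1^2z_2^2+z_2^4)$, $\;Q_8=8(z_1^2-2z_2^2)(2z_1^4-8z_1^2z_2^2-z_2^4)$, $\;R_8=z_3^2-z_1(2z_2+z_1)$. * $\Sigma_9$: $P_9=6^2(6z_1z_2-27z_1^4)$, $\;Q_9=6^3(z_2^2-18z_1^3z_2+54z_1^6)$, and $$R_9=z_3^9-72z_1z_2z_3^7-48(9z_1^3+2z_2)z_2z_3^6-864z_1^2z_2^2z_3^5-144z_1z_2^3z_3^4+48(36z_1^3+z_2)z_2^3z_3^3+1728z_1^2z_2^4z_3^2+576z_1z_2^5z_3+64z_2^6.$$ * $\Sigma_2^{(1)}$: $P=6^2(z_1-z_2^2)$, $\;Q=6^3z_1z_2$. * $\Sigma_2^{(3)}$: $P=-9(z_1^2+3z_2^2)$, $\;Q=54(z_2^3-z_2z_1^2)$. In each of these systems all the polynomials are quasi-homogeneous,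 that is, weighted homogeneous (each of its own weighted degree) for a suitable choice of positive integer weights of the variables, common to the system. Moreover: 1. for every $n\in\{3,4,5,7,8,9\}$, $E$ has a rational point of order $n$ if and only if $\Sigma_n$ has an integral solution $(z_1,\dots,z_4)\in\mathbb{Z}^4$; 2. $E$ has at least one rational point of order $2$ if and only if $\Sigma_2^{(1)}$ has an integral solution; 3. $E$ has exactly three rational points of order $2$ if and only if $\Sigma_2^{(3)}$ has an integral solution. -/

import Mathlib

noncomputable section

/-- The curve `Y² = X³ + A X + B`, with integers `A`, `B`, considered over `ℚ`. -/
def shortCurve (A B : ℤ) : WeierstrassCurve.Affine ℚ where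
  a₁ := 0
  a₂ := 0
  a₃ := 0
  a₄ := A
  a₆ := B

/-- The left hand sides `P`, `Q`, `R`, `S` of the four equations of a system, as integer
polynomials in four variables. A system that needs fewer equations has `R = 0` or `S = 0`, and a
system that needs fewer variables does not mention the last ones. -/
structure TorsionSystem where
  P : MvPolynomial (Fin 4) ℤ
  Q : MvPolynomial (Fin 4) ℤ
  R : MvPolynomial (Fin 4) ℤ
  S : MvPolynomial (Fin 4) ℤ

namespace TorsionSystem

open MvPolynomial

/-- The system `P = 6² A`, `Q = 6³ B`, `R = 0`, `S = 0` has an integral solution. -/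
def HasIntegralSolution (T : TorsionSystem) (A B : ℤ) : Prop :=
  ∃ z : Fin 4 → ℤ,
    eval z T.P = 6 ^ 2 * A ∧ eval z T.Q = 6 ^ 3 * B ∧ eval z T.R = 0 ∧ eval z T.S = 0

/-- All four polynomials are weighted homogeneous (each of its own weighted degree) for one common
choice of positive integer weights of the variables. -/
def IsQuasiHomogeneous (T : TorsionSystem) : Prop :=
  ∃ w : Fin 4 → ℕ, (∀ i, 0 < w i) ∧
    (∃ d, IsWeightedHomogeneous w T.P d) ∧ (∃ d, IsWeightedHomogeneous w T.Q d) ∧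
    (∃ d, IsWeightedHomogeneous w T.R d) ∧ (∃ d, IsWeightedHomogeneous w T.S d)

/-- The variable `z₁`. -/
abbrev z₁ : MvPolynomial (Fin 4) ℤ := X 0

/-- The variable `z₂`. -/
abbrev z₂ : MvPolynomial (Fin 4) ℤ := X 1

/-- The variable `z₃`. -/
abbrev z₃ : MvPolynomial (Fin 4) ℤ := X 2

/-- The variable `z₄`. -/
abbrev z₄ : MvPolynomial (Fin 4) ℤ := X 3

/-- The system for the existence of a point of order two. -/
def sigmaTwoOne : TorsionSystem where
  P := 6 ^ 2 * (z₁ - z₂ ^ 2)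
  Q := 6 ^ 3 * (z₁ * z₂)
  R := 0
  S := 0

/-- The system for the existence of three points of order two. -/
def sigmaTwoThree : TorsionSystem where
  P := -9 * (z₁ ^ 2 + 3 * z₂ ^ 2)
  Q := 54 * (z₂ ^ 3 - z₂ * z₁ ^ 2)
  R := 0
  S := 0

/-- The system for order three. -/
def sigmaThree : TorsionSystem where
  P := 6 ^ 2 * (27 * z₁ ^ 4 + 6 * z₁ * z₂)
  Q := 6 ^ 3 * (z₂ ^ 2 - 27 * z₁ ^ 6)
  R := 0
  S := 0

/-- The system for order four. -/
def sigmaFour : TorsionSystem where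
  P := 6 ^ 2 * (-3 * z₁ ^ 2 + 6 * z₁ * z₂ ^ 2 - 2 * z₂ ^ 4)
  Q := 6 ^ 3 * ((2 * z₁ - z₂ ^ 2) * (z₁ ^ 2 + 2 * z₁ * z₂ ^ 2 - z₂ ^ 4))
  R := 0
  S := 0

/-- The system for order five. -/
def sigmaFive : TorsionSystem where
  P := 18 * ((z₁ - z₂) ^ 2 - 6 * z₁ ^ 2 + (z₁ - z₂) * z₃ ^ 2)
  Q := 54 * ((z₁ + z₂) * (6 * z₁ ^ 2 - 2 * z₁ * z₂ + (z₂ - z₁) * z₃ ^ 2))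
  R := z₃ ^ 4 - 6 * z₃ ^ 2 * (z₁ + z₂) + (z₁ - z₂) ^ 2
  S := 0

/-- The system for order seven. -/
def sigmaSeven : TorsionSystem where
  P := -6 ^ 2 * ((z₁ + z₂) ^ 2 - z₁ * z₂ + z₄ * (z₂ - z₁))
  Q := 54 * (z₃ ^ 2 * (z₁ - z₂) ^ 2 + 4 * z₁ * (z₂ ^ 2 + z₁ * z₂ + z₂ * z₄ - z₁ * z₄))
  R := (2 * z₁ + z₂ + z₄) ^ 2 - z₃ ^ 2 * (2 * z₁ + z₂)
  S := -z₃ ^ 4 + (5 * z₁ + z₂ + 6 * z₄) * z₃ ^ 2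
    + (-3 * z₁ ^ 2 + 3 * z₂ ^ 2 - 8 * z₄ ^ 2 - 18 * z₁ * z₄ - 6 * z₂ * z₄)

/-- The system for order eight. -/
def sigmaEight : TorsionSystem where
  P := -12 * (z₁ ^ 4 - 4 * z₁ ^ 2 * z₂ ^ 2 + z₂ ^ 4)
  Q := 8 * ((z₁ ^ 2 - 2 * z₂ ^ 2) * (2 * z₁ ^ 4 - 8 * z₁ ^ 2 * z₂ ^ 2 - z₂ ^ 4))
  R := z₃ ^ 2 - z₁ * (2 * z₂ + z₁)
  S := 0

/-- The system for order nine. -/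
def sigmaNine : TorsionSystem where
  P := 6 ^ 2 * (6 * z₁ * z₂ - 27 * z₁ ^ 4)
  Q := 6 ^ 3 * (z₂ ^ 2 - 18 * z₁ ^ 3 * z₂ + 54 * z₁ ^ 6)
  R := z₃ ^ 9 - 72 * z₁ * z₂ * z₃ ^ 7 - 48 * (9 * z₁ ^ 3 + 2 * z₂) * z₂ * z₃ ^ 6
    - 864 * z₁ ^ 2 * z₂ ^ 2 * z₃ ^ 5 - 144 * z₁ * z₂ ^ 3 * z₃ ^ 4
    + 48 * (36 * z₁ ^ 3 + z₂) * z₂ ^ 3 * z₃ ^ 3 + 1728 * z₁ ^ 2 * z₂ ^ 4 * z₃ ^ 2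
    + 576 * z₁ * z₂ ^ 5 * z₃ + 64 * z₂ ^ 6
  S := 0

/-- The system attached to the order `n`, for `n` in `{3, 4, 5, 7, 8, 9}` (with an irrelevant value
for the other `n`). -/
def sigma : ℕ → TorsionSystem
  | 3 => sigmaThree
  | 4 => sigmaFour
  | 5 => sigmaFive
  | 7 => sigmaSeven
  | 8 => sigmaEight
  | 9 => sigmaNine
  | _ => ⟨0, 0, 0, 0⟩

end TorsionSystem

end

/-! For each order, the condition on a point `P` is a relation between tangent and chord slopes and
abscissas of small multiples of `P`. These quantities, suitably normalized, are the unknowns `zᵢ`.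
In one direction they must be shown to be integers; in the other, a solution gives back the slopes
and the point, and `4A³ + 27B² ≠ 0` excludes the degenerate parameters.

Integrality has two sources. For orders 2, 3, 4 and 8 it follows from monic equations: a two-torsion
abscissa is a root of the cubic, the tangent slope at a three-torsion point is a root of a monic
octic, and each halving extracts square roots of integers. For orders 5, 7 and 9, `exists_int_x`
uses the denominator `d²` of the abscissa: doubling can only enlarge `d`, and if it keeps `d` it
divides the numerator by 4 modulo `d⁴`. Since `2^k • P = P` for some `k`, this forces `d⁴ ∣ 4^k -
1`, hence `d = 1`.

The relations are: `2P = -P` (order 3); `2P` of order two (order 4) and one more halving (order 8);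
`x(2P) = x(3P)` (order 5); `x(4P) = x(3P)` (order 7); `x(2P) = x(P - T)` with `T = 3P` of order
three (order 9). -/

open WeierstrassCurve.Affine in
theorem shortCurve_nonsingular {A B : ℤ} (hD : 4 * A ^ 3 + 27 * B ^ 2 ≠ 0) {x y : ℚ}
    (h : y ^ 2 = x ^ 3 + A * x + B) : (shortCurve A B).Nonsingular x y := by
  rw [← equation_iff_nonsingular_of_Δ_ne_zero, equation_iff]
  · simpa [shortCurve] using h
  · have hD' : (4 * A ^ 3 + 27 * B ^ 2 : ℚ) ≠ 0 := mod_cast hD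
    intro h0
    apply hD'
    simp only [shortCurve, WeierstrassCurve.Δ, WeierstrassCurve.b₂, WeierstrassCurve.b₄,
      WeierstrassCurve.b₆, WeierstrassCurve.b₈] at h0
    linear_combination (-1 / 16) * h0

/-! ### Group law on the short Weierstrass curve -/

namespace shortCurve

open WeierstrassCurve.Affine WeierstrassCurve.Affine.Point

variable {A B : ℤ} {x y x₁ y₁ x₂ y₂ x₃ y₃ l : ℚ}

theorem equation (h : (shortCurve A B).Nonsingular x y) : y ^ 2 = x ^ 3 + A * x + B := by
  simpa [shortCurve] using (equation_iff _ _).1 h.1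

theorem negY_eq : (shortCurve A B).negY x y = -y := by
  simp [negY, shortCurve]

theorem neg_nonsingular (h : (shortCurve A B).Nonsingular x y) :
    (shortCurve A B).Nonsingular x (-y) := by
  simpa only [negY_eq] using (nonsingular_neg x y).2 h

theorem neg_some_eq (h : (shortCurve A B).Nonsingular x y) :
    -some x y h = some x (-y) (neg_nonsingular h) := by
  rw [neg_some]
  simp only [negY_eq]

theorem two_nsmul_eq_zero_iff (h : (shortCurve A B).Nonsingular x y) :
    2 • some x y h = 0 ↔ y = 0 := by
  rw [two_nsmul, add_eq_zero_iff_eq_neg, neg_some_eq h, some.injEq, self_eq_neg]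
  simp

theorem add_eq (h₁ : (shortCurve A B).Nonsingular x₁ y₁) (h₂ : (shortCurve A B).Nonsingular x₂ y₂)
    (h₃ : (shortCurve A B).Nonsingular x₃ y₃) (hx : x₁ ≠ x₂) (hl : l * (x₁ - x₂) = y₁ - y₂)
    (hx₃ : x₃ = l ^ 2 - x₁ - x₂) (hy₃ : y₃ = l * (x₁ - x₃) - y₁) :
    some x₁ y₁ h₁ + some x₂ y₂ h₂ = some x₃ y₃ h₃ := by
  have hs : (shortCurve A B).slope x₁ x₂ y₁ y₂ = l := by
    rw [slope_of_X_ne hx, div_eq_iff (sub_ne_zero.2 hx), hl]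
  rw [add_of_X_ne hx, some.injEq, hs]
  constructor
  · simp [addX, shortCurve, hx₃]
  · simp only [addY, negAddY, addX, negY, shortCurve, hy₃, hx₃]
    ring

theorem two_nsmul_eq (h₁ : (shortCurve A B).Nonsingular x₁ y₁)
    (h₃ : (shortCurve A B).Nonsingular x₃ y₃) (hy : y₁ ≠ 0) (hl : l * (2 * y₁) = 3 * x₁ ^ 2 + A)
    (hx₃ : x₃ = l ^ 2 - 2 * x₁) (hy₃ : y₃ = l * (x₁ - x₃) - y₁) :
    2 • some x₁ y₁ h₁ = some x₃ y₃ h₃ := by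
  have hy' : y₁ ≠ (shortCurve A B).negY x₁ y₁ := by rwa [negY_eq, Ne, self_eq_neg]
  have hs : (shortCurve A B).slope x₁ x₁ y₁ y₁ = l := by
    rw [slope_of_Y_ne rfl hy', negY_eq, div_eq_iff (by rw [sub_neg_eq_add]; simpa using hy)]
    simp only [shortCurve]
    linear_combination -hl
  rw [two_nsmul, add_self_of_Y_ne hy', some.injEq, hs]
  constructor
  · simp only [addX, shortCurve, hx₃]
    ring
  · simp only [addY, negAddY, addX, negY, shortCurve, hy₃, hx₃]
    ring

/-- The slope is given by a product relation instead of a quotient, so that later arguments are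
polynomial identities within reach of `linear_combination`. -/
theorem exists_add (hD : 4 * A ^ 3 + 27 * B ^ 2 ≠ 0) (h₁ : (shortCurve A B).Nonsingular x₁ y₁)
    (h₂ : (shortCurve A B).Nonsingular x₂ y₂) (hx : x₁ ≠ x₂) :
    ∃ (l x₃ y₃ : ℚ) (h₃ : (shortCurve A B).Nonsingular x₃ y₃), l * (x₁ - x₂) = y₁ - y₂ ∧
      x₃ = l ^ 2 - x₁ - x₂ ∧ y₃ = l * (x₁ - x₃) - y₁ ∧
      some x₁ y₁ h₁ + some x₂ y₂ h₂ = some x₃ y₃ h₃ := by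
  have hx' := sub_ne_zero.2 hx
  obtain ⟨l, hl⟩ : ∃ l, l * (x₁ - x₂) = y₁ - y₂ := ⟨_, div_mul_cancel₀ _ hx'⟩
  refine ⟨l, l ^ 2 - x₁ - x₂, l * (x₁ - (l ^ 2 - x₁ - x₂)) - y₁, shortCurve_nonsingular hD ?_, hl,
    rfl, rfl, add_eq _ _ _ hx hl rfl rfl⟩
  have e₁ := equation h₁
  have e₂ := equation h₂
  obtain rfl : y₂ = y₁ - l * (x₁ - x₂) := by linear_combination hl
  apply mul_left_cancel₀ hx'
  linear_combination (-(l ^ 2) + 2 * x₁ + x₂) * e₂ + (l ^ 2 - 2 * x₂ - x₁) * e₁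

theorem exists_two_nsmul (hD : 4 * A ^ 3 + 27 * B ^ 2 ≠ 0)
    (h₁ : (shortCurve A B).Nonsingular x₁ y₁) (hy : y₁ ≠ 0) :
    ∃ (l x₃ y₃ : ℚ) (h₃ : (shortCurve A B).Nonsingular x₃ y₃), l * (2 * y₁) = 3 * x₁ ^ 2 + A ∧
      x₃ = l ^ 2 - 2 * x₁ ∧ y₃ = l * (x₁ - x₃) - y₁ ∧ 2 • some x₁ y₁ h₁ = some x₃ y₃ h₃ := by
  have hy' : 2 * y₁ ≠ 0 := by simpa
  obtain ⟨l, hl⟩ : ∃ l, l * (2 * y₁) = 3 * x₁ ^ 2 + A := ⟨_, div_mul_cancel₀ _ hy'⟩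
  refine ⟨l, l ^ 2 - 2 * x₁, l * (x₁ - (l ^ 2 - 2 * x₁)) - y₁, shortCurve_nonsingular hD ?_, hl,
    rfl, rfl, two_nsmul_eq _ _ hy hl rfl rfl⟩
  have e₁ := equation h₁
  linear_combination e₁ + (l ^ 2 - 3 * x₁) * hl

theorem eq_or_add_eq_zero (h₁ : (shortCurve A B).Nonsingular x y₁)
    (h₂ : (shortCurve A B).Nonsingular x y₂) :
    some x y₁ h₁ = some x y₂ h₂ ∨ some x y₁ h₁ + some x y₂ h₂ = 0 := by
  rw [add_eq_zero_iff_eq_neg]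
  exact X_eq_iff.1 rfl

theorem exists_eq_some {P : (shortCurve A B).Point} (hP : P ≠ 0) :
    ∃ (x y : ℚ) (h : (shortCurve A B).Nonsingular x y), P = some x y h := by
  match P with
  | Point.zero => exact absurd rfl hP
  | Point.some x y h => exact ⟨x, y, h, rfl⟩

end shortCurve

/-! ### Integrality of rational roots -/

theorem Rat.exists_int_of_monic_root {p : Polynomial ℤ} (hp : p.Monic) {r : ℚ}
    (hr : Polynomial.aeval r p = 0) : ∃ n : ℤ, r = n := by
  obtain ⟨n, hn⟩ := isInteger_of_is_root_of_monic hp hr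
  exact ⟨n, by simpa using hn.symm⟩

theorem Rat.exists_int_of_pow_eq {r : ℚ} {k : ℕ} (hk : k ≠ 0) {m : ℤ} (h : r ^ k = m) :
    ∃ n : ℤ, r = n :=
  Rat.exists_int_of_monic_root (Polynomial.monic_X_pow_sub_C m hk) (by simp [h])

theorem Rat.exists_int_of_cubic {r : ℚ} {a b : ℤ} (h : r ^ 3 + a * r + b = 0) :
    ∃ n : ℤ, r = n :=
  Rat.exists_int_of_monic_root
    (p := Polynomial.X ^ 3 + (Polynomial.C a * Polynomial.X + Polynomial.C b)) (by monicity!)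
    (by simp [← add_assoc, h])

/-! ### Denominators of abscissas under doubling -/

namespace shortCurve

open WeierstrassCurve.Affine WeierstrassCurve.Affine.Point

variable {A B : ℤ}

theorem exists_int_y {a : ℤ} {y : ℚ} (h : (shortCurve A B).Nonsingular a y) :
    ∃ n : ℤ, y = n :=
  Rat.exists_int_of_pow_eq two_ne_zero (m := a ^ 3 + A * a + B) (by
    rw [equation h]
    push_cast
    ring)

/-- The abscissa of a rational point is a fraction in lowest terms whose denominator is a
square. -/
theorem exists_x_eq {x y : ℚ} (h : (shortCurve A B).Nonsingular x y) :
    ∃ u d : ℤ, 0 < d ∧ IsCoprime u d ∧ x * d ^ 2 = u := by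
  have e := equation h
  have hq : (x.den : ℚ) ≠ 0 := by exact_mod_cast x.den_ne_zero
  have hx : x * x.den = x.num := Rat.mul_den_eq_num x
  have hcop : IsCoprime x.num (x.den : ℤ) := Rat.isCoprime_num_den x
  generalize hp : x.num = p at *
  have hqpos : (0 : ℤ) < x.den := by exact_mod_cast x.den_pos
  obtain ⟨q, hq'⟩ : ∃ q : ℤ, (x.den : ℤ) = q := ⟨_, rfl⟩
  have hq'' : (x.den : ℚ) = q := by exact_mod_cast congrArg (Int.cast : ℤ → ℚ) hq'
  rw [hq''] at hq hx
  rw [hq'] at hcop hqpos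
  -- With `x = p / q`, the equation times `q⁴` has the square of an integer on the left and two
  -- coprime factors on the right; as `q > 0`, it is a square.
  have key : (y * q ^ 2) ^ 2 = ((q * (p ^ 3 + (A * p * q + B * q ^ 2) * q) : ℤ) : ℚ) := by
    push_cast
    rw [← hx]
    linear_combination (q : ℚ) ^ 4 * e
  obtain ⟨w, hw⟩ := Rat.exists_int_of_pow_eq two_ne_zero key
  rw [hw] at key
  have key' : q * (p ^ 3 + (A * p * q + B * q ^ 2) * q) = w ^ 2 := by exact_mod_cast key.symm
  have hc : IsCoprime q (p ^ 3 + (A * p * q + B * q ^ 2) * q) :=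
    (IsCoprime.add_mul_right_left (hcop.pow_left (m := 3)) _).symm
  obtain ⟨d, hd | hd⟩ := Int.sq_of_isCoprime hc key'
  · refine ⟨p, |d|, abs_pos.2 ?_, ?_, ?_⟩
    · rintro rfl
      simp [hd] at hqpos
    · rw [hd] at hcop
      exact (IsCoprime.pow_right_iff two_pos).1 (by rwa [sq_abs])
    · rw [← hx, hd]
      push_cast
      rw [sq_abs]
  · nlinarith [sq_nonneg d]

/-- Duplication does not shrink the denominator of the abscissa. If it preserves it,
it divides the numerator by `4` modulo the fourth power of the denominator. -/
theorem dvd_of_two_nsmul (hD : 4 * A ^ 3 + 27 * B ^ 2 ≠ 0) {x y x' y' : ℚ}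
    {h : (shortCurve A B).Nonsingular x y} {h' : (shortCurve A B).Nonsingular x' y'}
    (h2 : 2 • some x y h = some x' y' h') {u d u' d' : ℤ} (hd : 0 < d) (hd' : 0 < d')
    (hc : IsCoprime u d) (hx : x * d ^ 2 = u) (hx' : x' * d' ^ 2 = u') :
    d ∣ d' ∧ (d = d' → d ^ 4 ∣ 4 * u' - u) := by
  have hy : y ≠ 0 := by
    rintro rfl
    rw [(two_nsmul_eq_zero_iff h).2 rfl] at h2
    exact some_ne_zero _ h2.symm
  obtain ⟨l, x₃, y₃, h₃, hl, hx₃, -, h2'⟩ := exists_two_nsmul hD h hy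
  obtain ⟨rfl, -⟩ := some.inj (h2.symm.trans h2')
  have e := equation h
  -- The duplication formula for the abscissa; `key` is its version with denominators cleared.
  have dup : 4 * x' * (x ^ 3 + A * x + B) = x ^ 4 - 2 * A * x ^ 2 - 8 * B * x + A ^ 2 := by
    rw [hx₃]
    linear_combination (l * (2 * y) + 3 * x ^ 2 + A) * hl - (4 * l ^ 2) * e
  have key : d ^ 2 * (4 * (u ^ 3 + A * u * d ^ 4 + B * d ^ 6) * u') =
      (u ^ 4 - 2 * A * u ^ 2 * d ^ 4 - 8 * B * u * d ^ 6 + A ^ 2 * d ^ 8) * d' ^ 2 := by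
    have : (d ^ 2 * (4 * (u ^ 3 + A * u * d ^ 4 + B * d ^ 6) * u') : ℚ) =
      (u ^ 4 - 2 * A * u ^ 2 * d ^ 4 - 8 * B * u * d ^ 6 + A ^ 2 * d ^ 8) * d' ^ 2 := by
      rw [← hx, ← hx']
      linear_combination (d : ℚ) ^ 8 * d' ^ 2 * dup
    exact_mod_cast this
  constructor
  -- The numerator is `u⁴` modulo `d²`, so nothing in `d²` cancels against it.
  · have hcN : IsCoprime (d ^ 2)
        (u ^ 4 - 2 * A * u ^ 2 * d ^ 4 - 8 * B * u * d ^ 6 + A ^ 2 * d ^ 8) := by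
      have := IsCoprime.add_mul_right_left (hc.pow (m := 4) (n := 2))
        ((-2 * A * u ^ 2 - 8 * B * u * d ^ 2 + A ^ 2 * d ^ 4) * d ^ 2)
      refine (congrArg (IsCoprime (d ^ 2)) ?_).mp this.symm
      ring
    exact (Int.pow_dvd_pow_iff two_ne_zero).1 (hcN.dvd_of_dvd_mul_left ⟨_, key.symm⟩)
  -- After cancelling `d²`, both sides modulo `d⁴` read `4u³u' ≡ u⁴`, and `u` is invertible modulo
  -- `d`.
  · rintro rfl
    have key' := mul_left_cancel₀ (pow_ne_zero 2 hd.ne') (key.trans (mul_comm _ _))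
    refine (hc.symm.pow (m := 4) (n := 3)).dvd_of_dvd_mul_left
      ⟨-(4 * (A * u + B * d ^ 2) * u') + (- 2 * A * u ^ 2 - 8 * B * u * d ^ 2 + A ^ 2 * d ^ 4), ?_⟩
    linear_combination key'

theorem dvd_of_two_pow_nsmul (hD : 4 * A ^ 3 + 27 * B ^ 2 ≠ 0) (k : ℕ) {x y : ℚ}
    {h : (shortCurve A B).Nonsingular x y} {u d : ℤ} (hd : 0 < d) (hc : IsCoprime u d)
    (hx : x * d ^ 2 = u) : ∀ {x' y' : ℚ} {h' : (shortCurve A B).Nonsingular x' y'}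
    (_ : 2 ^ k • some x y h = some x' y' h') {u' d' : ℤ} (_ : 0 < d') (_ : IsCoprime u' d')
    (_ : x' * d' ^ 2 = u'), d ∣ d' ∧ (d = d' → d ^ 4 ∣ 4 ^ k * u' - u) := by
  induction k with
  | zero =>
    intro x' y' h' h2 u' d' hd' hc' hx'
    obtain ⟨rfl, -⟩ := some.inj ((one_nsmul _).symm.trans h2)
    have hdd : (u : ℤ) * d' ^ 2 = u' * d ^ 2 := by
      have : (u * d' ^ 2 : ℚ) = u' * d ^ 2 := by rw [← hx, ← hx']; ring
      exact_mod_cast this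
    refine ⟨(Int.pow_dvd_pow_iff two_ne_zero).1
      ((hc.symm.pow_left (m := 2)).dvd_of_dvd_mul_left (hdd ▸ dvd_mul_left _ _)), ?_⟩
    rintro rfl
    rw [mul_right_cancel₀ (pow_ne_zero 2 hd.ne') hdd]
    simp
  | succ k ih =>
    intro x' y' h' h2 u' d' hd' hc' hx'
    rw [pow_succ, mul_nsmul] at h2
    obtain ⟨x₁, y₁, h₁, hP⟩ := exists_eq_some (P := 2 ^ k • some x y h) (by
      intro h0
      rw [h0, nsmul_zero] at h2
      exact some_ne_zero _ h2.symm)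
    rw [hP] at h2
    obtain ⟨u₁, d₁, hd₁, hc₁, hx₁⟩ := exists_x_eq h₁
    obtain ⟨i, j⟩ := ih hP hd₁ hc₁ hx₁
    obtain ⟨i', j'⟩ := dvd_of_two_nsmul hD h2 hd₁ hd' hc₁ hx₁ hx'
    refine ⟨i.trans i', ?_⟩
    rintro rfl
    obtain rfl := Int.dvd_antisymm hd.le hd₁.le i i'
    obtain ⟨s, hs⟩ := j rfl
    obtain ⟨t, ht⟩ := j' rfl
    exact ⟨s + 4 ^ k * t, by rw [pow_succ]; linear_combination hs + 4 ^ k * ht⟩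

theorem exists_int_x_of_two_pow_nsmul_eq (hD : 4 * A ^ 3 + 27 * B ^ 2 ≠ 0) {k : ℕ} {x y : ℚ}
    {h : (shortCurve A B).Nonsingular x y} (h2 : 2 ^ k • some x y h = some x y h)
    (hk : ∀ d : ℤ, 0 < d → d ^ 4 ∣ 4 ^ k - 1 → d = 1) : ∃ n : ℤ, x = n := by
  obtain ⟨u, d, hd, hc, hx⟩ := exists_x_eq h
  have hdvd := (dvd_of_two_pow_nsmul hD k hd hc hx h2 hd hc hx).2 rfl
  rw [show 4 ^ k * u - u = u * (4 ^ k - 1) by ring] at hdvd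
  obtain rfl := hk d hd ((hc.symm.pow_left (m := 4)).dvd_of_dvd_mul_left hdvd)
  exact ⟨u, by simpa using hx⟩

/-- `2⁴ ≡ 1` modulo 5 and `2⁶ ≡ 1` modulo 7 and 9, while `4⁴ - 1 = 3·5·17` and `4⁶ - 1 = 3²·5·7·13`
have no fourth power factor. -/
theorem exists_int_x (hD : 4 * A ^ 3 + 27 * B ^ 2 ≠ 0) {n : ℕ} (hn : n = 5 ∨ n = 7 ∨ n = 9)
    {x y : ℚ} {h : (shortCurve A B).Nonsingular x y} (ho : addOrderOf (some x y h) = n) :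
    ∃ m : ℤ, x = m := by
  have h63 : ∀ d : ℤ, 0 < d → d ^ 4 ∣ 4095 → d = 1 := by
    intro d hd hdvd
    have hle := Int.le_of_dvd (by norm_num) hdvd
    have : d < 8 := by
      by_contra! h8
      have := pow_le_pow_left₀ (by norm_num) h8 4
      omega
    interval_cases d <;> omega
  have h0 : n • some x y h = 0 := ho ▸ addOrderOf_nsmul_eq_zero _
  have hmul (m : ℕ) : (m * n + 1) • some x y h = some x y h := by
    rw [add_nsmul, mul_nsmul', h0, nsmul_zero, zero_add, one_nsmul]
  have h4095 : ((4 : ℤ) ^ 6 - 1) = 4095 := by norm_num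
  rcases hn with rfl | rfl | rfl
  · refine exists_int_x_of_two_pow_nsmul_eq hD (k := 4) (hmul 3) fun d hd hdvd ↦ ?_
    have : d ^ 4 ∣ 255 := by simpa using hdvd
    have hle := Int.le_of_dvd (by norm_num) this
    have : d < 4 := by
      by_contra! h4
      have := pow_le_pow_left₀ (by norm_num) h4 4
      omega
    interval_cases d <;> omega
  · exact exists_int_x_of_two_pow_nsmul_eq hD (k := 6) (hmul 9) fun d hd hdvd ↦
      h63 d hd (h4095 ▸ hdvd)
  · exact exists_int_x_of_two_pow_nsmul_eq hD (k := 6) (hmul 7) fun d hd hdvd ↦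
      h63 d hd (h4095 ▸ hdvd)

end shortCurve

theorem Rat.exists_int_of_octic {r : ℚ} {a b c : ℤ} (h : r ^ 8 + a * r ^ 4 + b * r ^ 2 + c = 0) :
    ∃ n : ℤ, r = n :=
  Rat.exists_int_of_monic_root (p := Polynomial.X ^ 8 + (Polynomial.C a * Polynomial.X ^ 4 +
    Polynomial.C b * Polynomial.X ^ 2 + Polynomial.C c)) (by monicity!) (by simp [← add_assoc, h])

/-! ### Orders two, three and four -/

namespace TorsionSystem

variable {A B : ℤ}

theorem hasIntegralSolution_iff {T : TorsionSystem} : T.HasIntegralSolution A B ↔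
    ∃ a b c d : ℤ, MvPolynomial.eval ![a, b, c, d] T.P = 6 ^ 2 * A ∧
      MvPolynomial.eval ![a, b, c, d] T.Q = 6 ^ 3 * B ∧
      MvPolynomial.eval ![a, b, c, d] T.R = 0 ∧ MvPolynomial.eval ![a, b, c, d] T.S = 0 := by
  constructor
  · rintro ⟨z, hz⟩
    refine ⟨z 0, z 1, z 2, z 3, ?_⟩
    convert hz <;> (ext i; fin_cases i <;> rfl)
  · rintro ⟨a, b, c, d, h⟩
    exact ⟨_, h⟩

theorem hasIntegralSolution_sigmaTwoOne : sigmaTwoOne.HasIntegralSolution A B ↔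
    ∃ a b : ℤ, A = a - b ^ 2 ∧ B = a * b := by
  simp [hasIntegralSolution_iff, sigmaTwoOne, eq_comm]

theorem hasIntegralSolution_sigmaTwoThree : sigmaTwoThree.HasIntegralSolution A B ↔
    ∃ a b : ℤ, -(a ^ 2 + 3 * b ^ 2) = 4 * A ∧ b ^ 3 - b * a ^ 2 = 4 * B := by
  simp only [hasIntegralSolution_iff, sigmaTwoThree]
  simp
  refine exists_congr fun a ↦ exists_congr fun b ↦ and_congr ?_ ?_ <;> constructor <;> intro h <;>
    linarith

theorem hasIntegralSolution_sigmaThree : sigmaThree.HasIntegralSolution A B ↔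
    ∃ a b : ℤ, A = 27 * a ^ 4 + 6 * a * b ∧ B = b ^ 2 - 27 * a ^ 6 := by
  simp [hasIntegralSolution_iff, sigmaThree, eq_comm]

theorem hasIntegralSolution_sigmaFour : sigmaFour.HasIntegralSolution A B ↔
    ∃ a b : ℤ, A = -3 * a ^ 2 + 6 * a * b ^ 2 - 2 * b ^ 4 ∧
      B = (2 * a - b ^ 2) * (a ^ 2 + 2 * a * b ^ 2 - b ^ 4) := by
  simp [hasIntegralSolution_iff, sigmaFour, eq_comm]

end TorsionSystem

namespace shortCurve

open WeierstrassCurve.Affine WeierstrassCurve.Affine.Point TorsionSystem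

variable {A B : ℤ}

theorem addOrderOf_eq_two_iff {P : (shortCurve A B).Point} :
    addOrderOf P = 2 ↔ ∃ (x : ℤ) (h : (shortCurve A B).Nonsingular (x : ℚ) 0),
      P = some (x : ℚ) 0 h := by
  constructor
  · intro hP
    obtain ⟨x, y, h, rfl⟩ := exists_eq_some (P := P) (by
      rintro rfl
      simp at hP)
    obtain rfl := (two_nsmul_eq_zero_iff h).1 (hP ▸ addOrderOf_nsmul_eq_zero _)
    have e := equation h
    obtain ⟨n, rfl⟩ := Rat.exists_int_of_cubic (r := x) (a := A) (b := B)
      (by linear_combination -e)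
    exact ⟨n, h, rfl⟩
  · rintro ⟨x, h, rfl⟩
    exact addOrderOf_eq_prime ((two_nsmul_eq_zero_iff h).2 rfl) (some_ne_zero h)

theorem exists_addOrderOf_eq_two_iff (hD : 4 * A ^ 3 + 27 * B ^ 2 ≠ 0) :
    (∃ P : (shortCurve A B).Point, addOrderOf P = 2) ↔ sigmaTwoOne.HasIntegralSolution A B := by
  simp only [addOrderOf_eq_two_iff, hasIntegralSolution_sigmaTwoOne]
  constructor
  · rintro ⟨-, x, h, rfl⟩
    have e : (0 : ℤ) ^ 2 = x ^ 3 + A * x + B := by exact_mod_cast equation h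
    -- The cubic factors as `(X - x)(X² + xX + A + x²)`.
    exact ⟨A + x ^ 2, -x, by ring, by linear_combination -e⟩
  · rintro ⟨a, b, rfl, rfl⟩
    exact ⟨_, -b, shortCurve_nonsingular hD (by push_cast; ring), rfl⟩

theorem encard_addOrderOf_eq_two_iff (hD : 4 * A ^ 3 + 27 * B ^ 2 ≠ 0) :
    {P : (shortCurve A B).Point | addOrderOf P = 2}.encard = 3 ↔
      sigmaTwoThree.HasIntegralSolution A B := by
  rw [hasIntegralSolution_sigmaTwoThree, Set.encard_eq_three]
  constructor
  · rintro ⟨P, Q, R, hPQ, hPR, hQR, hS⟩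
    obtain ⟨p, hp, rfl⟩ := addOrderOf_eq_two_iff.1 (show P ∈ {P | addOrderOf P = 2} by simp [hS])
    obtain ⟨q, hq, rfl⟩ := addOrderOf_eq_two_iff.1 (show Q ∈ {P | addOrderOf P = 2} by simp [hS])
    obtain ⟨r, hr, rfl⟩ := addOrderOf_eq_two_iff.1 (show R ∈ {P | addOrderOf P = 2} by simp [hS])
    have ep : (0 : ℤ) ^ 2 = p ^ 3 + A * p + B := by exact_mod_cast equation hp
    have eq : (0 : ℤ) ^ 2 = q ^ 3 + A * q + B := by exact_mod_cast equation hq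
    have er : (0 : ℤ) ^ 2 = r ^ 3 + A * r + B := by exact_mod_cast equation hr
    have hpq : p - q ≠ 0 := sub_ne_zero.2 (by rintro rfl; exact hPQ rfl)
    have hpr : p - r ≠ 0 := sub_ne_zero.2 (by rintro rfl; exact hPR rfl)
    have hqr : q - r ≠ 0 := sub_ne_zero.2 (by rintro rfl; exact hQR rfl)
    have h₁ : p ^ 2 + p * q + q ^ 2 + A = 0 :=
      mul_left_cancel₀ hpq (by linear_combination eq - ep)
    have h₂ : p ^ 2 + p * r + r ^ 2 + A = 0 :=
      mul_left_cancel₀ hpr (by linear_combination er - ep)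
    obtain rfl : r = -p - q :=
      mul_left_cancel₀ hqr (by linear_combination h₁ - h₂)
    -- The first witness is `q - r`; the roots are then `-b` and `(b ± a) / 2`.
    refine ⟨2 * q + p, -p, ?_, ?_⟩
    · linear_combination -4 * h₁
    · linear_combination 4 * ep + 4 * p * h₁
  · rintro ⟨a, b, hA, hB⟩
    have hA' : -(a ^ 2 + 3 * b ^ 2 : ℚ) = 4 * A := by exact_mod_cast hA
    have hB' : (b ^ 3 - b * a ^ 2 : ℚ) = 4 * B := by exact_mod_cast hB
    have h₁ : (shortCurve A B).Nonsingular (-b) 0 :=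
      shortCurve_nonsingular hD (by linear_combination (-b * hA' + hB') / 4)
    have h₂ : (shortCurve A B).Nonsingular ((b + a) / 2) 0 :=
      shortCurve_nonsingular hD (by linear_combination ((b + a) / 2 * hA' + hB') / 4)
    have h₃ : (shortCurve A B).Nonsingular ((b - a) / 2) 0 :=
      shortCurve_nonsingular hD (by linear_combination ((b - a) / 2 * hA' + hB') / 4)
    -- Up to a constant, this is the product of the differences of the roots.
    have hD' : (a : ℚ) * (3 * b + a) * (3 * b - a) ≠ 0 := by
      have hD' : (4 * A ^ 3 + 27 * B ^ 2 : ℚ) ≠ 0 := mod_cast hD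
      intro h0
      apply hD'
      rw [show (A : ℚ) = -(a ^ 2 + 3 * b ^ 2) / 4 by linear_combination -hA' / 4,
        show (B : ℚ) = (b ^ 3 - b * a ^ 2) / 4 by linear_combination -hB' / 4]
      linear_combination (-1 / 16) * (a : ℚ) * (3 * b + a) * (3 * b - a) * h0
    simp only [mul_ne_zero_iff] at hD'
    obtain ⟨⟨ha, hb⟩, hc⟩ := hD'
    refine ⟨some _ _ h₁, some _ _ h₂, some _ _ h₃, ?_, ?_, ?_, ?_⟩
    · rw [Ne, some.injEq]
      rintro ⟨h, -⟩
      exact hb (by linear_combination -2 * h)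
    · rw [Ne, some.injEq]
      rintro ⟨h, -⟩
      exact hc (by linear_combination -2 * h)
    · rw [Ne, some.injEq]
      rintro ⟨h, -⟩
      exact ha (by linear_combination h)
    · ext P
      simp only [Set.mem_ofPred_eq, Set.mem_insert_iff, Set.mem_singleton_iff]
      constructor
      · intro hP
        obtain ⟨x, h, rfl⟩ := addOrderOf_eq_two_iff.1 hP
        simp only [some.injEq, and_true]
        have e := equation h
        have : ((x : ℚ) - -b) * ((x - (b + a) / 2) * (x - (b - a) / 2)) = 0 := by
          linear_combination -e + (x * hA' + hB') / 4
        simpa only [mul_eq_zero, sub_eq_zero] using this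
      · rintro (rfl | rfl | rfl) <;>
          exact addOrderOf_eq_prime ((two_nsmul_eq_zero_iff _).2 rfl) (some_ne_zero _)

/-- Since `2P = -P`, the tangent slope satisfies `l² = 3x`. Substituting `x = l² / 3` in the
3-division polynomial gives a monic octic for `l`, which is then an integer divisible by 3; `a` is
`l / 3`. -/
theorem exists_of_addOrderOf_eq_three (hD : 4 * A ^ 3 + 27 * B ^ 2 ≠ 0) {x y : ℚ}
    {h : (shortCurve A B).Nonsingular x y} (ho : 3 • some x y h = 0) :
    ∃ a b : ℤ, x = 3 * a ^ 2 ∧ y = b + 9 * a ^ 3 ∧ A = 27 * a ^ 4 + 6 * a * b ∧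
      B = b ^ 2 - 27 * a ^ 6 := by
  rw [succ_nsmul] at ho
  have hy : y ≠ 0 := by
    rintro rfl
    rw [(two_nsmul_eq_zero_iff h).2 rfl, zero_add] at ho
    exact some_ne_zero h ho
  obtain ⟨l, x₂, y₂, h₂, hl, hx₂, -, hP⟩ := exists_two_nsmul hD h hy
  rw [hP, add_eq_zero_iff_eq_neg, neg_some_eq, some.injEq] at ho
  obtain rfl := ho.1
  have e := equation h
  have hx : x₂ = l ^ 2 / 3 := by linear_combination hx₂ / 3
  have key : l ^ 8 + 18 * A * l ^ 4 + 108 * B * l ^ 2 - 27 * A ^ 2 = 0 := by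
    have : 3 * x₂ ^ 4 + 6 * A * x₂ ^ 2 + 12 * B * x₂ - A ^ 2 = 0 := by
      linear_combination (-(l * (2 * y) + 3 * x₂ ^ 2 + A)) * hl * (-1) + 4 * y ^ 2 * hx₂
        - 12 * x₂ * e
    rw [hx] at this
    linear_combination 27 * this
  obtain ⟨m, rfl⟩ := Rat.exists_int_of_octic (r := l) (a := 18 * A) (b := 108 * B)
    (c := -27 * A ^ 2) (by push_cast; linear_combination key)
  have key' : m ^ 8 + 18 * A * m ^ 4 + 108 * B * m ^ 2 - 27 * A ^ 2 = 0 := by exact_mod_cast key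
  obtain ⟨a, rfl⟩ : 3 ∣ m := Int.prime_three.dvd_of_dvd_pow (n := 8)
    ⟨-(6 * A * m ^ 4 + 36 * B * m ^ 2 - 9 * A ^ 2), by linear_combination key'⟩
  obtain rfl : x₂ = (3 * a ^ 2 : ℤ) := by
    rw [hx]
    push_cast
    ring
  obtain ⟨n, rfl⟩ := exists_int_y h
  push_cast at hl e
  have hA : A = 27 * a ^ 4 + 6 * a * (n - 9 * a ^ 3) := by
    have : (A : ℚ) = 27 * a ^ 4 + 6 * a * (n - 9 * a ^ 3) := by linear_combination -hl
    exact_mod_cast this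
  have e' : n ^ 2 = (3 * a ^ 2) ^ 3 + A * (3 * a ^ 2) + B := by
    apply Int.cast_injective (α := ℚ)
    push_cast
    exact e
  refine ⟨a, n - 9 * a ^ 3, by push_cast; ring, by push_cast; ring, hA, ?_⟩
  linear_combination -e' - 3 * a ^ 2 * hA

theorem three_nsmul_eq_zero (hD : 4 * A ^ 3 + 27 * B ^ 2 ≠ 0) {a b : ℤ}
    (hA : A = 27 * a ^ 4 + 6 * a * b) (hB : B = b ^ 2 - 27 * a ^ 6) {x y : ℚ}
    (h : (shortCurve A B).Nonsingular x y) (hx : x = 3 * a ^ 2) (hy : y = b + 9 * a ^ 3) :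
    3 • some x y h = 0 := by
  have hy0 : y ≠ 0 := by
    rw [hy]
    intro h0
    have h0' : b + 9 * a ^ 3 = 0 := by exact_mod_cast h0
    obtain rfl : b = -9 * a ^ 3 := by linear_combination h0'
    apply hD
    rw [hA, hB]
    ring
  rw [succ_nsmul, two_nsmul_eq h (neg_nonsingular h) hy0 (l := 3 * a) ?_ ?_ ?_, ← neg_some_eq h,
    neg_add_cancel]
  · rw [hA, hx, hy]
    push_cast
    ring
  · rw [hx]
    ring
  · ring

theorem exists_addOrderOf_eq_three_iff (hD : 4 * A ^ 3 + 27 * B ^ 2 ≠ 0) :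
    (∃ P : (shortCurve A B).Point, addOrderOf P = 3) ↔ sigmaThree.HasIntegralSolution A B := by
  rw [hasIntegralSolution_sigmaThree]
  constructor
  · rintro ⟨P, hP⟩
    obtain ⟨x, y, h, rfl⟩ := exists_eq_some (P := P) (by
      rintro rfl
      simp at hP)
    obtain ⟨a, b, -, -, h₁, h₂⟩ :=
      exists_of_addOrderOf_eq_three hD (h := h) (hP ▸ addOrderOf_nsmul_eq_zero _)
    exact ⟨a, b, h₁, h₂⟩
  · rintro ⟨a, b, hA, hB⟩
    have h : (shortCurve A B).Nonsingular (3 * a ^ 2 : ℚ) (b + 9 * a ^ 3) :=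
      shortCurve_nonsingular hD (by rw [hA, hB]; push_cast; ring)
    exact ⟨some _ _ h, addOrderOf_eq_prime (three_nsmul_eq_zero hD hA hB h rfl rfl)
      (some_ne_zero h)⟩

/-- Parametrization of the points whose double is a given point of order two. -/
theorem exists_of_two_nsmul_eq (hD : 4 * A ^ 3 + 27 * B ^ 2 ≠ 0) {x y e : ℚ}
    {h : (shortCurve A B).Nonsingular x y} {h' : (shortCurve A B).Nonsingular e 0}
    (h2 : 2 • some x y h = some e 0 h') :
    ∃ a b : ℤ, x = a ∧ e = (b ^ 2 - 2 * a : ℤ) ∧ y = b * (3 * a - b ^ 2) ∧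
      A = -3 * a ^ 2 + 6 * a * b ^ 2 - 2 * b ^ 4 ∧
      B = (2 * a - b ^ 2) * (a ^ 2 + 2 * a * b ^ 2 - b ^ 4) := by
  have hy : y ≠ 0 := by
    rintro rfl
    rw [(two_nsmul_eq_zero_iff h).2 rfl] at h2
    exact some_ne_zero _ h2.symm
  obtain ⟨l, x₃, y₃, h₃, hl, hx₃, hy₃, h2'⟩ := exists_two_nsmul hD h hy
  obtain ⟨rfl, rfl⟩ := some.inj (h2.symm.trans h2')
  have eP := equation h
  have eQ := equation h'
  have hxe : x - e ≠ 0 := by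
    intro h0
    rw [h0] at hy₃
    exact hy (by linear_combination hy₃)
  have hA : A = 2 * l ^ 2 * (x - e) - 3 * x ^ 2 := by linear_combination -hl + 2 * l * hy₃
  -- The right side is the derivative of the cubic at the integer `e`, so `x - e` is an integer;
  -- then so is the tangent slope `l`, because `l² = e + 2x`. The unknowns are `a = x` and `b = l`.
  have hu : (x - e) ^ 2 = 3 * e ^ 2 + A := by
    rw [hA]
    linear_combination (2 * (x - e)) * hx₃
  obtain ⟨n, rfl⟩ := Rat.exists_int_of_cubic (r := e) (a := A) (b := B) (by linear_combination -eQ)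
  obtain ⟨u, hu'⟩ := Rat.exists_int_of_pow_eq two_ne_zero (m := 3 * n ^ 2 + A)
    (by rw [hu]; push_cast; ring)
  obtain ⟨a, rfl⟩ : ∃ a : ℤ, x = a := ⟨u + n, by push_cast; linear_combination hu'⟩
  obtain ⟨b, rfl⟩ := Rat.exists_int_of_pow_eq (r := l) two_ne_zero (m := n + 2 * a)
    (by push_cast; linear_combination -hx₃)
  have hn : n = b ^ 2 - 2 * a := by exact_mod_cast hx₃
  have hA' : A = 2 * b ^ 2 * (a - n) - 3 * a ^ 2 := by exact_mod_cast hA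
  subst hn
  have eQ' : (0 : ℤ) ^ 2 = (b ^ 2 - 2 * a) ^ 3 + A * (b ^ 2 - 2 * a) + B := by exact_mod_cast eQ
  push_cast at hy₃
  refine ⟨a, b, rfl, rfl, by linear_combination hy₃, by rw [hA']; ring, ?_⟩
  rw [hA'] at eQ'
  linear_combination -eQ'

theorem exists_nsmul_eq_of_addOrderOf_eq_two_mul {P : (shortCurve A B).Point} {n : ℕ}
    (hP : addOrderOf P = 2 * n) (hn : n ≠ 0) :
    ∃ (e : ℤ) (h : (shortCurve A B).Nonsingular (e : ℚ) 0), n • P = some (e : ℚ) 0 h := by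
  apply addOrderOf_eq_two_iff.1
  rw [addOrderOf_nsmul_of_dvd hn (hP ▸ dvd_mul_left _ _), hP, Nat.mul_div_cancel _ (by omega)]

theorem exists_addOrderOf_eq_four_iff (hD : 4 * A ^ 3 + 27 * B ^ 2 ≠ 0) :
    (∃ P : (shortCurve A B).Point, addOrderOf P = 4) ↔ sigmaFour.HasIntegralSolution A B := by
  rw [hasIntegralSolution_sigmaFour]
  constructor
  · rintro ⟨P, hP⟩
    obtain ⟨e, he, h2⟩ := exists_nsmul_eq_of_addOrderOf_eq_two_mul (n := 2) hP two_ne_zero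
    obtain ⟨x, y, h, rfl⟩ := exists_eq_some (P := P) (by
      rintro rfl
      simp at hP)
    obtain ⟨a, b, -, -, -, h₁, h₂⟩ := exists_of_two_nsmul_eq hD h2
    exact ⟨a, b, h₁, h₂⟩
  · rintro ⟨a, b, hA, hB⟩
    have h : (shortCurve A B).Nonsingular (a : ℚ) (b * (3 * a - b ^ 2)) :=
      shortCurve_nonsingular hD (by rw [hA, hB]; push_cast; ring)
    have h' : (shortCurve A B).Nonsingular (b ^ 2 - 2 * a : ℚ) 0 :=
      shortCurve_nonsingular hD (by rw [hA, hB]; push_cast; ring)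
    have hy : (b * (3 * a - b ^ 2) : ℚ) ≠ 0 := by
      intro h0
      have h0' : b * (3 * a - b ^ 2) = 0 := by exact_mod_cast h0
      apply hD
      rw [hA, hB]
      obtain rfl | hb := mul_eq_zero.1 h0'
      · ring
      · rw [show b ^ 4 = (b ^ 2) ^ 2 by ring, show b ^ 2 = 3 * a by linear_combination -hb]
        ring
    have h2 := two_nsmul_eq h h' hy (l := b) (by rw [hA]; push_cast; ring) (by ring) (by ring)
    refine ⟨some _ _ h, addOrderOf_eq_prime_pow (p := 2) (n := 1) ?_ ?_⟩
    · rw [pow_one, h2]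
      exact some_ne_zero _
    · rw [pow_succ, mul_nsmul, pow_one, h2, two_nsmul_eq_zero_iff]

end shortCurve

/-! ### Orders five and seven -/

namespace TorsionSystem

variable {A B : ℤ}

theorem hasIntegralSolution_sigmaFive : sigmaFive.HasIntegralSolution A B ↔
    ∃ a b c : ℤ, (a - b) ^ 2 - 6 * a ^ 2 + (a - b) * c ^ 2 = 2 * A ∧
      (a + b) * (6 * a ^ 2 - 2 * a * b + (b - a) * c ^ 2) = 4 * B ∧
      c ^ 4 - 6 * c ^ 2 * (a + b) + (a - b) ^ 2 = 0 := by
  simp only [hasIntegralSolution_iff, sigmaFive]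
  simp
  refine exists_congr fun a ↦ exists_congr fun b ↦ exists_congr fun c ↦
    and_congr ?_ (and_congr ?_ Iff.rfl) <;> constructor <;> intro h <;> linarith

theorem hasIntegralSolution_sigmaSeven : sigmaSeven.HasIntegralSolution A B ↔
    ∃ a b c d : ℤ, -((a + b) ^ 2 - a * b + d * (b - a)) = A ∧
      c ^ 2 * (a - b) ^ 2 + 4 * a * (b ^ 2 + a * b + b * d - a * d) = 4 * B ∧
      (2 * a + b + d) ^ 2 - c ^ 2 * (2 * a + b) = 0 ∧
      -c ^ 4 + (5 * a + b + 6 * d) * c ^ 2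
        + (-3 * a ^ 2 + 3 * b ^ 2 - 8 * d ^ 2 - 18 * a * d - 6 * b * d) = 0 := by
  simp only [hasIntegralSolution_iff, sigmaSeven]
  simp
  refine exists_congr fun a ↦ exists_congr fun b ↦ exists_congr fun c ↦ exists_congr fun d ↦
    and_congr ?_ (and_congr ?_ Iff.rfl) <;> constructor <;> intro h <;> linarith

end TorsionSystem

namespace shortCurve

open WeierstrassCurve.Affine WeierstrassCurve.Affine.Point TorsionSystem

variable {A B : ℤ}

/-- The cubic would be `(X - e)²(X + 2e)`. Degenerate parameter values are excluded this way. -/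
theorem false_of_singular (hD : 4 * A ^ 3 + 27 * B ^ 2 ≠ 0) {e : ℚ} (hA : A = -3 * e ^ 2)
    (hB : B = 2 * e ^ 3) : False := by
  have hD' : (4 * A ^ 3 + 27 * B ^ 2 : ℚ) ≠ 0 := mod_cast hD
  apply hD'
  rw [hA, hB]
  ring

theorem exists_eq_some_of_addOrderOf {P : (shortCurve A B).Point} {n : ℕ} (hP : addOrderOf P = n)
    (hn : 3 ≤ n) : ∃ (x y : ℚ) (h : (shortCurve A B).Nonsingular x y), P = some x y h ∧ y ≠ 0 := by
  obtain ⟨x, y, h, rfl⟩ := exists_eq_some (P := P) (by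
    rintro rfl
    rw [addOrderOf_zero] at hP
    omega)
  refine ⟨x, y, h, rfl, ?_⟩
  intro hy
  have := Nat.le_of_dvd two_pos (addOrderOf_dvd_of_nsmul_eq_zero ((two_nsmul_eq_zero_iff h).2 hy))
  omega

theorem nsmul_eq_zero_of_addOrderOf_eq {G : Type*} [AddMonoid G] {P : G} {n : ℕ}
    (hP : addOrderOf P = n) : n • P = 0 :=
  hP ▸ addOrderOf_nsmul_eq_zero P

/-- A point with its double and its triple, in terms of the slope `m` of its tangent and the slope
`k` of the line that joins it to its double. -/
theorem exists_two_three_nsmul (hD : 4 * A ^ 3 + 27 * B ^ 2 ≠ 0) {x y : ℚ}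
    {h : (shortCurve A B).Nonsingular x y} (hy : y ≠ 0) (h3 : 3 • some x y h ≠ 0) :
    ∃ (m k x₂ y₂ x₃ y₃ : ℚ) (h₂ : (shortCurve A B).Nonsingular x₂ y₂)
      (h₃ : (shortCurve A B).Nonsingular x₃ y₃), 2 • some x y h = some x₂ y₂ h₂ ∧
      3 • some x y h = some x₃ y₃ h₃ ∧ x₂ = m ^ 2 - 2 * x ∧ x₃ = k ^ 2 - x - x₂ ∧
      y = (m + k) * (x - x₂) / 2 ∧ y₂ = (m - k) * (x - x₂) / 2 ∧
      (A : ℚ) = m * (m + k) * (x - x₂) - 3 * x ^ 2 ∧ x ≠ x₂ := by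
  obtain ⟨m, x₂, y₂, h₂, hm, hx₂, hy₂, h2⟩ := exists_two_nsmul hD h hy
  have hx : x ≠ x₂ := by
    rintro rfl
    obtain h' | h' := eq_or_add_eq_zero h h₂
    · rw [h', two_nsmul, add_eq_left] at h2
      exact some_ne_zero _ h2
    · exact h3 (by rw [succ_nsmul', h2, h'])
  obtain ⟨k, x₃, y₃, h₃, hk, hx₃, -, h3'⟩ := exists_add hD h h₂ hx
  have hy' : y = (m + k) * (x - x₂) / 2 := by linear_combination (hy₂ - hk) / 2
  refine ⟨m, k, x₂, y₂, x₃, y₃, h₂, h₃, h2, by rw [succ_nsmul', h2, h3'], hx₂, hx₃, hy',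
    by linear_combination hy₂ - hy', ?_, hx⟩
  linear_combination -hm + 2 * m * hy'

/-- Converse of `exists_two_three_nsmul`: the point is rebuilt from the two slopes and the two
abscissas. -/
theorem exists_point_of_slopes (hD : 4 * A ^ 3 + 27 * B ^ 2 ≠ 0) {m k x x₂ : ℚ}
    (hx₂ : x₂ = m ^ 2 - 2 * x) (hA : (A : ℚ) = m * (m + k) * (x - x₂) - 3 * x ^ 2)
    (hB : (B : ℚ) = ((m + k) * (x - x₂) / 2) ^ 2 - x ^ 3 - A * x) (hx : x ≠ x₂) (hmk : m + k ≠ 0) :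
    ∃ (h : (shortCurve A B).Nonsingular x ((m + k) * (x - x₂) / 2))
      (h₂ : (shortCurve A B).Nonsingular x₂ ((m - k) * (x - x₂) / 2)) (y₃ : ℚ)
      (h₃ : (shortCurve A B).Nonsingular (k ^ 2 - x - x₂) y₃),
      2 • some _ _ h = some _ _ h₂ ∧ 3 • some _ _ h = some _ _ h₃ := by
  have h : (shortCurve A B).Nonsingular x ((m + k) * (x - x₂) / 2) :=
    shortCurve_nonsingular hD (by rw [hB]; ring)
  have hy : (m + k) * (x - x₂) / 2 ≠ 0 :=
    div_ne_zero (mul_ne_zero hmk (sub_ne_zero.2 hx)) two_ne_zero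
  have h₂ : (shortCurve A B).Nonsingular x₂ ((m - k) * (x - x₂) / 2) :=
    shortCurve_nonsingular hD (by rw [hB, hA, hx₂]; ring)
  have h2 := two_nsmul_eq h h₂ hy (l := m) (by rw [hA]; ring) hx₂ (by ring)
  obtain ⟨l, x₃, y₃, h₃, hl, hx₃, -, h3⟩ := exists_add hD h h₂ hx
  obtain rfl : l = k := mul_right_cancel₀ (sub_ne_zero.2 hx) (by rw [hl]; ring)
  subst hx₃
  exact ⟨h, h₂, y₃, h₃, h2, by rw [succ_nsmul', h2, h3]⟩

theorem exists_addOrderOf_eq_five_iff (hD : 4 * A ^ 3 + 27 * B ^ 2 ≠ 0) :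
    (∃ P : (shortCurve A B).Point, addOrderOf P = 5) ↔ sigmaFive.HasIntegralSolution A B := by
  rw [hasIntegralSolution_sigmaFive]
  constructor
  · rintro ⟨P, hP⟩
    obtain ⟨x, y, h, rfl, hy⟩ := exists_eq_some_of_addOrderOf hP (by norm_num)
    obtain ⟨m, k, x₂, y₂, x₃, y₃, h₂, h₃, h2, h3, hx₂, hx₃, hy', -, hA, hx⟩ :=
      exists_two_three_nsmul hD (h := h) hy
        (nsmul_ne_zero_of_lt_addOrderOf three_ne_zero (by rw [hP]; norm_num))
    obtain rfl : x₃ = x₂ := by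
      have h5 : 3 • some x y h + 2 • some x y h = 0 := by
        rw [← add_nsmul]
        exact nsmul_eq_zero_of_addOrderOf_eq hP
      rw [h2, h3, add_eq_zero_iff_eq_neg, neg_some_eq, some.injEq] at h5
      exact h5.1
    have ho₂ : addOrderOf (some x₃ y₂ h₂) = 5 := by
      rw [← h2, (Nat.Coprime.addOrderOf_nsmul (by rw [hP]; norm_num)), hP]
    obtain ⟨a, rfl⟩ := exists_int_x hD (by norm_num) hP
    obtain ⟨b, rfl⟩ := exists_int_x hD (by norm_num) ho₂
    obtain ⟨m, rfl⟩ := Rat.exists_int_of_pow_eq (r := m) two_ne_zero (m := 2 * a + b)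
      (by push_cast; linear_combination -hx₂)
    obtain ⟨k, rfl⟩ := Rat.exists_int_of_pow_eq (r := k) two_ne_zero (m := a + 2 * b)
      (by push_cast; linear_combination -hx₃)
    have e := equation h
    have hm' : m ^ 2 = 2 * a + b := by
      have : (m ^ 2 : ℚ) = 2 * a + b := by linear_combination -hx₂
      exact_mod_cast this
    have hk' : k ^ 2 = a + 2 * b := by
      have : (k ^ 2 : ℚ) = a + 2 * b := by linear_combination -hx₃
      exact_mod_cast this
    have hA' : A = m * (m + k) * (a - b) - 3 * a ^ 2 := by exact_mod_cast hA
    have hB' : 4 * B = ((m + k) * (a - b)) ^ 2 - 4 * a ^ 3 - 4 * A * a := by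
      have : (4 * B : ℚ) = ((m + k) * (a - b)) ^ 2 - 4 * a ^ 3 - 4 * A * a := by
        rw [hy'] at e
        linear_combination -4 * e
      exact_mod_cast this
    -- The unknowns are `x(P)`, `x(2P)` and the sum of the slopes, with `m² = 2a + b` and `k² = a +
    -- 2b`.
    refine ⟨a, b, m + k, ?_, ?_, ?_⟩
    · rw [hA']
      linear_combination (a - b) * (hk' - hm')
    · rw [hB', hA']
      linear_combination 2 * a * (a - b) * (hm' - hk')
    · linear_combination 2 * (m + k) ^ 2 * (hm' + hk') - (a - b + m ^ 2 - k ^ 2) * (hm' - hk')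
  · rintro ⟨a, b, c, h₁, h₂, h₃⟩
    have h₁' : ((a - b) ^ 2 - 6 * a ^ 2 + (a - b) * c ^ 2 : ℚ) = 2 * A := by exact_mod_cast h₁
    have h₂' : ((a + b) * (6 * a ^ 2 - 2 * a * b + (b - a) * c ^ 2) : ℚ) = 4 * B := by
      exact_mod_cast h₂
    have h₃' : (c ^ 4 - 6 * c ^ 2 * (a + b) + (a - b) ^ 2 : ℚ) = 0 := by exact_mod_cast h₃
    have hab : (a : ℚ) ≠ b := by
      intro hab
      rw [← hab] at h₁' h₂'
      exact false_of_singular hD (e := a) (by linear_combination -h₁' / 2)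
        (by linear_combination -h₂' / 4)
    have hc : (c : ℚ) ≠ 0 := by
      intro hc
      rw [hc] at h₃'
      exact hab (sub_eq_zero.1 (pow_eq_zero_iff two_ne_zero |>.1 (by linear_combination h₃')))
    -- `t` plays the role of `m - k`: the product `(m - k)(m + k)` is `m² - k² = a - b`.
    obtain ⟨t, ht⟩ : ∃ t : ℚ, t * c = a - b := ⟨_, div_mul_cancel₀ _ hc⟩
    have ht2 : c ^ 2 + t ^ 2 = 6 * (a + b) := by
      apply mul_left_cancel₀ (pow_ne_zero 2 hc)
      linear_combination h₃' + (t * c + a - b) * ht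
    have hsum : ((c + t) / 2 + (c - t) / 2 : ℚ) = c := by ring
    obtain ⟨h, h₂, y₃, h₃, h2, h3⟩ := exists_point_of_slopes hD (m := (c + t) / 2)
      (k := (c - t) / 2) (x := a) (x₂ := b) (by linear_combination -ht2 / 4 - ht / 2)
      (by rw [hsum]; linear_combination -h₁' / 2 - (a - b) / 2 * ht)
      (by rw [hsum]; linear_combination -h₂' / 4 - a / 2 * h₁') hab (by rwa [hsum])
    have : Fact (Nat.Prime 5) := ⟨by norm_num⟩
    refine ⟨_, addOrderOf_eq_prime (p := 5) ?_ (some_ne_zero h)⟩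
    have hx₃ : ((c - t) / 2) ^ 2 - a - b = b := by linear_combination ht2 / 4 - ht / 2
    rw [show 5 = 3 + 2 from rfl, add_nsmul, h3, h2]
    simp only [hx₃] at h₃ h3 ⊢
    -- `3P` and `2P` share their abscissa, and `3P = 2P` would give `P = 0`.
    obtain h' | h' := eq_or_add_eq_zero h₃ h₂
    · rw [h', ← h2, succ_nsmul, add_eq_left] at h3
      exact absurd h3 (some_ne_zero h)
    · exact h'

theorem exists_addOrderOf_eq_seven_iff (hD : 4 * A ^ 3 + 27 * B ^ 2 ≠ 0) :
    (∃ P : (shortCurve A B).Point, addOrderOf P = 7) ↔ sigmaSeven.HasIntegralSolution A B := by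
  rw [hasIntegralSolution_sigmaSeven]
  constructor
  · rintro ⟨P, hP⟩
    obtain ⟨x, y, h, rfl, hy⟩ := exists_eq_some_of_addOrderOf hP (by norm_num)
    obtain ⟨m, k, x₂, y₂, x₃, y₃, h₂, h₃, h2, h3, hx₂, hx₃, hy', hy₂', hA, hx⟩ :=
      exists_two_three_nsmul hD (h := h) hy
        (nsmul_ne_zero_of_lt_addOrderOf three_ne_zero (by rw [hP]; norm_num))
    have ho₂ : addOrderOf (some x₂ y₂ h₂) = 7 := by
      rw [← h2, (Nat.Coprime.addOrderOf_nsmul (by rw [hP]; norm_num)), hP]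
    have ho₃ : addOrderOf (some x₃ y₃ h₃) = 7 := by
      rw [← h3, (Nat.Coprime.addOrderOf_nsmul (by rw [hP]; norm_num)), hP]
    obtain ⟨l, x₄, y₄, h₄, hl, hx₄, -, h4⟩ := exists_two_nsmul hD h₂ (by
      intro h0
      have := nsmul_ne_zero_of_lt_addOrderOf (x := some x₂ y₂ h₂) two_ne_zero
        (by rw [ho₂]; norm_num)
      exact this ((two_nsmul_eq_zero_iff h₂).2 h0))
    obtain rfl : x₄ = x₃ := by
      have h7 : 2 • 2 • some x y h + 3 • some x y h = 0 := by
        rw [← mul_nsmul, ← add_nsmul]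
        exact nsmul_eq_zero_of_addOrderOf_eq hP
      rw [h2, h3, h4, add_eq_zero_iff_eq_neg, neg_some_eq, some.injEq] at h7
      exact h7.1
    -- The tangent slope at `2P` in terms of `m` and `k`; squared, it turns `x(4P) = x(3P)` into the
    -- equation `key`, which becomes `S = 0`.
    have hl' : l * (m - k) = m * k - x - 2 * x₂ := by
      apply mul_left_cancel₀ (sub_ne_zero.2 hx)
      linear_combination hl + hA - 2 * l * hy₂' - (x - x₂) * hx₂
    obtain ⟨a, rfl⟩ := exists_int_x hD (by norm_num) hP
    obtain ⟨b, rfl⟩ := exists_int_x hD (by norm_num) ho₂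
    obtain ⟨c, rfl⟩ := exists_int_x hD (by norm_num) ho₃
    obtain ⟨m, rfl⟩ := Rat.exists_int_of_pow_eq (r := m) two_ne_zero (m := 2 * a + b)
      (by push_cast; linear_combination -hx₂)
    obtain ⟨k, rfl⟩ := Rat.exists_int_of_pow_eq (r := k) two_ne_zero (m := a + b + c)
      (by push_cast; linear_combination -hx₃)
    have key : (m * k - a - 2 * b) ^ 2 = (m - k) ^ 2 * (k ^ 2 - a + b) := by
      have : ((m * k - a - 2 * b) ^ 2 : ℚ) = (m - k) ^ 2 * (k ^ 2 - a + b) := by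
        rw [← hl']
        linear_combination (m - k : ℚ) ^ 2 * (hx₃ - hx₄)
      exact_mod_cast this
    have e := equation h
    have hb : b = m ^ 2 - 2 * a := by exact_mod_cast hx₂
    have hA' : A = m * (m + k) * (a - b) - 3 * a ^ 2 := by exact_mod_cast hA
    have hB' : 4 * B = ((m + k) * (a - b)) ^ 2 - 4 * a ^ 3 - 4 * A * a := by
      have : (4 * B : ℚ) = ((m + k) * (a - b)) ^ 2 - 4 * a ^ 3 - 4 * A * a := by
        rw [hy'] at e
        linear_combination -4 * e
      exact_mod_cast this
    rw [hb] at key hA' hB'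
    rw [hA'] at hB'
    refine ⟨a, b, m + k, m * k, ?_, ?_, ?_, ?_⟩
    · rw [hA', hb]
      ring
    · rw [hB', hb]
      ring
    · rw [hb]
      ring
    · rw [hb]
      linear_combination key
  · rintro ⟨a, b, c, d, h₁, h₂, h₃, h₄⟩
    have h₁' : (-((a + b) ^ 2 - a * b + d * (b - a)) : ℚ) = A := by exact_mod_cast h₁
    have h₂' : (c ^ 2 * (a - b) ^ 2 + 4 * a * (b ^ 2 + a * b + b * d - a * d) : ℚ) = 4 * B := by
      exact_mod_cast h₂
    have h₃' : ((2 * a + b + d) ^ 2 - c ^ 2 * (2 * a + b) : ℚ) = 0 := by exact_mod_cast h₃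
    have h₄' : (-c ^ 4 + (5 * a + b + 6 * d) * c ^ 2
        + (-3 * a ^ 2 + 3 * b ^ 2 - 8 * d ^ 2 - 18 * a * d - 6 * b * d) : ℚ) = 0 := by
      exact_mod_cast h₄
    have hab : (a : ℚ) ≠ b := by
      intro hab
      rw [← hab] at h₁' h₂'
      exact false_of_singular hD (e := a) (by linear_combination -h₁')
        (by linear_combination -h₂' / 4)
    have hc : (c : ℚ) ≠ 0 := by
      intro hc
      rw [hc] at h₃' h₄'
      have hd : (d : ℚ) = -(2 * a + b) := by
        have := pow_eq_zero_iff two_ne_zero |>.1 (show (2 * a + b + d : ℚ) ^ 2 = 0 by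
          linear_combination h₃')
        linear_combination this
      rw [hd] at h₄'
      exact hab (sub_eq_zero.1 (pow_eq_zero_iff two_ne_zero |>.1 (by linear_combination h₄')))
    -- With `c = m + k` and `d = mk`, the product `mc` is `m² + mk`, and `m²` should be `2a + b`;
    -- the equation `R = 0` confirms this.
    obtain ⟨m, hm⟩ : ∃ m : ℚ, m * c = 2 * a + b + d := ⟨_, div_mul_cancel₀ _ hc⟩
    have hb : (b : ℚ) = m ^ 2 - 2 * a := by
      apply mul_left_cancel₀ (pow_ne_zero 2 hc)
      linear_combination -h₃' - (m * c + 2 * a + b + d) * hm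
    obtain ⟨k, hk⟩ : ∃ k, (c : ℚ) = m + k := ⟨c - m, by ring⟩
    have hd : (d : ℚ) = m * k := by
      rw [hk, hb] at hm
      linear_combination -hm
    rw [hk, hd] at h₂' h₄'
    rw [hd] at h₁'
    have key : (m * k - a - 2 * b) ^ 2 = (m - k) ^ 2 * (k ^ 2 - a + b) := by
      rw [hb] at h₄' ⊢
      linear_combination h₄'
    have hA : (A : ℚ) = m * (m + k) * (a - b) - 3 * a ^ 2 := by
      linear_combination -h₁' + (a - b) * hb
    -- This is the nonvanishing of the ordinate of `2P`.
    have hmk : m - k ≠ 0 := by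
      intro h0
      obtain rfl : k = m := by linear_combination -h0
      have := pow_eq_zero_iff two_ne_zero |>.1 (show (k * k - a - 2 * b) ^ 2 = 0 by
        rw [key]
        ring)
      exact hab (by linear_combination this + hb)
    obtain ⟨h, h₂, y₃, h₃, h2, h3⟩ := exists_point_of_slopes hD (m := m)
      (k := k) (x := a) (x₂ := b) hb hA (by linear_combination -h₂' / 4 - a * h₁') hab
      (by rwa [← hk])
    obtain ⟨l, x₄, y₄, h₄, hl, hx₄, -, h4⟩ := exists_two_nsmul hD h₂
      (div_ne_zero (mul_ne_zero hmk (sub_ne_zero.2 hab)) two_ne_zero)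
    have hl' : l * (m - k) = m * k - a - 2 * b := by
      apply mul_left_cancel₀ (sub_ne_zero.2 hab)
      linear_combination hl + hA - (a - b) * hb
    obtain rfl : x₄ = k ^ 2 - a - b := by
      apply mul_left_cancel₀ (pow_ne_zero 2 hmk)
      linear_combination (m - k) ^ 2 * hx₄ + key + (l * (m - k) + (m * k - a - 2 * b)) * hl'
    have : Fact (Nat.Prime 7) := ⟨by norm_num⟩
    refine ⟨_, addOrderOf_eq_prime (p := 7) ?_ (some_ne_zero h)⟩
    rw [show 7 = 2 * 2 + 3 from rfl, add_nsmul, mul_nsmul, h2, h3, h4]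
    obtain h' | h' := eq_or_add_eq_zero h₄ h₃
    · rw [← h4, ← h3, ← h2, ← mul_nsmul, succ_nsmul _ 3, add_eq_left] at h'
      exact absurd h' (some_ne_zero h)
    · exact h'

end shortCurve

/-! ### Orders eight and nine -/

namespace TorsionSystem

variable {A B : ℤ}

theorem hasIntegralSolution_sigmaEight : sigmaEight.HasIntegralSolution A B ↔
    ∃ a b c : ℤ, -(a ^ 4 - 4 * a ^ 2 * b ^ 2 + b ^ 4) = 3 * A ∧
      (a ^ 2 - 2 * b ^ 2) * (2 * a ^ 4 - 8 * a ^ 2 * b ^ 2 - b ^ 4) = 27 * B ∧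
      c ^ 2 - a * (2 * b + a) = 0 := by
  simp only [hasIntegralSolution_iff, sigmaEight]
  simp
  refine exists_congr fun a ↦ exists_congr fun b ↦ and_congr ?_ (and_congr ?_ Iff.rfl) <;>
    constructor <;> intro h <;> linarith

theorem hasIntegralSolution_sigmaNine : sigmaNine.HasIntegralSolution A B ↔
    ∃ a b c : ℤ, 6 * a * b - 27 * a ^ 4 = A ∧ b ^ 2 - 18 * a ^ 3 * b + 54 * a ^ 6 = B ∧
      c ^ 9 - 72 * a * b * c ^ 7 - 48 * (9 * a ^ 3 + 2 * b) * b * c ^ 6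
      - 864 * a ^ 2 * b ^ 2 * c ^ 5 - 144 * a * b ^ 3 * c ^ 4
      + 48 * (36 * a ^ 3 + b) * b ^ 3 * c ^ 3 + 1728 * a ^ 2 * b ^ 4 * c ^ 2
      + 576 * a * b ^ 5 * c + 64 * b ^ 6 = 0 := by
  simp [hasIntegralSolution_iff, sigmaNine]

end TorsionSystem

namespace shortCurve

open WeierstrassCurve.Affine WeierstrassCurve.Affine.Point TorsionSystem

variable {A B : ℤ}

/-- The halving criterion for a point `(u, b u)` of order four on `y² = x ((x - u)² + b² x)`. -/
theorem exists_of_halving {u b x y l : ℚ} (hb : b ≠ 0) (hu : u ≠ 0) (hy : y ≠ 0)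
    (he : y ^ 2 = x * ((x - u) ^ 2 + b ^ 2 * x))
    (hl : l * (2 * y) = (3 * x - u) * (x - u) + 2 * b ^ 2 * x)
    (hx : l ^ 2 = b ^ 2 - u + 2 * x) (hQ : b * u = l * (x - u) - y) :
    ∃ r : ℚ, r ^ 2 = u ∧ (l - r) ^ 2 = b ^ 2 + 2 * b * r := by
  have hy2 : 2 * y ≠ 0 := by simpa
  have h₁ : 4 * y ^ 2 * u = (x ^ 2 - u ^ 2) ^ 2 := by
    -- This is the duplication formula with the two-torsion point at the origin; it exhibits `u` as
    -- the square of `(x² - u²) / (2y)`.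
    linear_combination (l * (2 * y) + (3 * x - u) * (x - u) + 2 * b ^ 2 * x) * hl
      - 4 * y ^ 2 * hx + (4 * b ^ 2 + 8 * x - 8 * u) * he * (-1)
  have h₂ : (x - u) ^ 4 = 4 * u * b ^ 2 * x ^ 2 := by
    linear_combination -h₁ + 4 * u * he
  -- The ordinate of the double fixes the sign that `h₁` and `h₂` leave open, hence the sign of `br`
  -- in the conclusion.
  have h₃ : 2 * y * b * u = (x - u) ^ 3 - 2 * b ^ 2 * x * u := by
    linear_combination 2 * y * hQ + (x - u) * hl - 2 * he
  have h₄ : y * (x - u) = b * x * (x + u) := by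
    apply mul_left_cancel₀ (mul_ne_zero hb hu)
    linear_combination (x - u) / 2 * h₃ + h₂ / 2
  obtain ⟨r, hr⟩ : ∃ r, r * (2 * y) = x ^ 2 - u ^ 2 := ⟨_, div_mul_cancel₀ _ hy2⟩
  have hru : r ^ 2 = u := by
    apply mul_left_cancel₀ (pow_ne_zero 2 hy2)
    linear_combination (r * (2 * y) + x ^ 2 - u ^ 2) * hr - h₁
  refine ⟨r, hru, ?_⟩
  have : x - l * r = b * r := by
    apply mul_left_cancel₀ hy2
    linear_combination h₄ - (l + b) * hr + (x + u) * hQ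
  linear_combination hx + hru + 2 * this

theorem exists_addOrderOf_eq_eight_iff (hD : 4 * A ^ 3 + 27 * B ^ 2 ≠ 0) :
    (∃ P : (shortCurve A B).Point, addOrderOf P = 8) ↔ sigmaEight.HasIntegralSolution A B := by
  rw [hasIntegralSolution_sigmaEight]
  constructor
  · rintro ⟨P, hP⟩
    obtain ⟨e, he, h4⟩ := exists_nsmul_eq_of_addOrderOf_eq_two_mul (n := 4) hP (by norm_num)
    obtain ⟨x, y, h, rfl, hy⟩ := exists_eq_some_of_addOrderOf hP (by norm_num)
    obtain ⟨l, x₂, y₂, h₂, hl, hx₂, hy₂, h2⟩ := exists_two_nsmul hD h hy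
    rw [show 4 = 2 * 2 from rfl, mul_nsmul, h2] at h4
    obtain ⟨a, b, rfl, hae, rfl, hA, hB⟩ := exists_of_two_nsmul_eq hD h4
    have e' := equation h
    have hA' : (A : ℚ) = -3 * a ^ 2 + 6 * a * b ^ 2 - 2 * b ^ 4 := by exact_mod_cast hA
    have hB' : (B : ℚ) = (2 * a - b ^ 2) * (a ^ 2 + 2 * a * b ^ 2 - b ^ 4) := by
      exact_mod_cast hB
    rw [hA', hB'] at e'
    rw [hA'] at hl
    -- Abscissas are shifted by that of `4P`, namely `b² - 2a`; thus `2P` becomes `(u, bu)`. If `b`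
    -- or `u` vanished, the curve would be singular.
    obtain ⟨r, hr, hlr⟩ := exists_of_halving (u := 3 * a - b ^ 2) (b := b)
      (x := x - (b ^ 2 - 2 * a)) (y := y) (l := l)
      (fun hb ↦ false_of_singular hD (e := a) (by rw [hA', hb]; ring) (by rw [hB', hb]; ring))
      (fun hu ↦ false_of_singular hD (e := a)
        (by linear_combination hA' + (2 * b ^ 2) * hu)
        (by linear_combination hB' + (a * b ^ 2 - (b : ℚ) ^ 4) * hu))
      hy (by linear_combination e') (by linear_combination hl) (by linear_combination -hx₂)
      (by linear_combination hy₂)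
    obtain ⟨r, rfl⟩ := Rat.exists_int_of_pow_eq (r := r) two_ne_zero (m := 3 * a - b ^ 2)
      (by push_cast; exact hr)
    obtain ⟨c, hc⟩ := Rat.exists_int_of_pow_eq (r := l - r) two_ne_zero (m := b ^ 2 + 2 * b * r)
      (by push_cast; exact hlr)
    rw [hc] at hlr
    have hr' : r ^ 2 = 3 * a - b ^ 2 := by exact_mod_cast hr
    have hc' : c ^ 2 = b ^ 2 + 2 * b * r := by exact_mod_cast hlr
    refine ⟨b, r, c, ?_, ?_, ?_⟩
    · rw [show r ^ 4 = (r ^ 2) ^ 2 by ring, hr', hA]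
      ring
    · rw [show r ^ 4 = (r ^ 2) ^ 2 by ring, hr', hB]
      ring
    · rw [hc']
      ring
  · rintro ⟨b, r, c, h₁, h₂, h₃⟩
    have h₁' : (-(b ^ 4 - 4 * b ^ 2 * r ^ 2 + r ^ 4) : ℚ) = 3 * A := by exact_mod_cast h₁
    have h₂' : ((b ^ 2 - 2 * r ^ 2) * (2 * b ^ 4 - 8 * b ^ 2 * r ^ 2 - r ^ 4) : ℚ) = 27 * B := by
      exact_mod_cast h₂
    have h₃' : (c ^ 2 - b * (2 * r + b) : ℚ) = 0 := by exact_mod_cast h₃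
    have hA : (A : ℚ) = -(b ^ 4 - 4 * b ^ 2 * r ^ 2 + r ^ 4) / 3 := by linear_combination -h₁' / 3
    have hB : (B : ℚ) = (b ^ 2 - 2 * r ^ 2) * (2 * b ^ 4 - 8 * b ^ 2 * r ^ 2 - r ^ 4) / 27 := by
      linear_combination -h₂' / 27
    have hb : (b : ℚ) ≠ 0 := by
      intro hb
      rw [hb] at hA hB
      exact false_of_singular hD (e := r ^ 2 / 3) (by rw [hA]; ring) (by rw [hB]; ring)
    have hr : (r : ℚ) ≠ 0 := by
      intro hr
      rw [hr] at hA hB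
      exact false_of_singular hD (e := b ^ 2 / 3) (by rw [hA]; ring) (by rw [hB]; ring)
    have hc : (c : ℚ) ≠ 0 := by
      intro hc
      rw [hc] at h₃'
      have hb' : (b : ℚ) = -2 * r := by
        apply mul_left_cancel₀ hb
        linear_combination -h₃'
      rw [hb'] at hA hB
      exact false_of_singular hD (e := r ^ 2 / -3) (by rw [hA]; ring) (by rw [hB]; ring)
    have hbrc : (b + r + c : ℚ) ≠ 0 := by
      intro h0
      have hc' : (c : ℚ) = -b - r := by linear_combination h0
      rw [hc'] at h₃'
      exact hr (pow_eq_zero_iff two_ne_zero |>.1 (by linear_combination h₃'))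
    have hQ : (shortCurve A B).Nonsingular ((r ^ 2 + b ^ 2) / 3) (b * r ^ 2) :=
      shortCurve_nonsingular hD (by rw [hA, hB]; ring)
    have he : (shortCurve A B).Nonsingular ((b ^ 2 - 2 * r ^ 2) / 3) 0 :=
      shortCurve_nonsingular hD (by rw [hA, hB]; ring)
    -- The tangent slope here is `l = c + r`, and the halving relation `x - lr = br` gives the
    -- shifted abscissa `r(b + r + c)`.
    have h : (shortCurve A B).Nonsingular (r * (b + r + c) + (b ^ 2 - 2 * r ^ 2) / 3)
        (c * (r * (b + r + c))) :=
      shortCurve_nonsingular hD (by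
        rw [hA, hB]
        linear_combination (r * (b + r + c)) * (r * (b + r + c) - r ^ 2) * h₃')
    have h2 := two_nsmul_eq h hQ
      (mul_ne_zero hc (mul_ne_zero hr hbrc)) (l := c + r)
      (by
        rw [hA]
        linear_combination (2 * r * (b + r + c) - r ^ 2) * h₃')
      (by linear_combination -h₃') (by ring)
    have h4 := two_nsmul_eq hQ he (mul_ne_zero hb (pow_ne_zero 2 hr)) (l := b)
      (by rw [hA]; ring) (by ring) (by ring)
    refine ⟨some _ _ h, addOrderOf_eq_prime_pow (p := 2) (n := 2) ?_ ?_⟩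
    · rw [show 2 ^ 2 = 2 * 2 from rfl, mul_nsmul, h2, h4]
      exact some_ne_zero _
    · rw [show 2 ^ (2 + 1) = 2 * 2 * 2 from rfl, mul_nsmul, mul_nsmul, h2, h4,
        two_nsmul_eq_zero_iff]

/-- Let `T = (3a², b)` have order three and let `c` be the abscissa measured from `T`, so that the
curve is `y² = c³ + (3ac + b)²`. The relation `x(2P) = x(P - T)` is linear in `y` once `y²` is
replaced by this cubic. Squaring eliminates `y`, and the result is `c³` times the polynomial `R₉`.
-/
theorem trisection_identity (a b c : ℚ) :
    ((3 * c ^ 2 + 18 * a ^ 2 * c + 6 * a * b) ^ 2 * c ^ 2 - 4 * (c ^ 3 + (3 * a * c + b) ^ 2) *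
      (c ^ 3 + (3 * a * c + b) ^ 2 + c ^ 3 + b ^ 2)) ^ 2 -
      64 * (c ^ 3 + (3 * a * c + b) ^ 2) ^ 3 * b ^ 2 =
    c ^ 3 * (c ^ 9 - 72 * a * b * c ^ 7 - 48 * (9 * a ^ 3 + 2 * b) * b * c ^ 6
      - 864 * a ^ 2 * b ^ 2 * c ^ 5 - 144 * a * b ^ 3 * c ^ 4
      + 48 * (36 * a ^ 3 + b) * b ^ 3 * c ^ 3 + 1728 * a ^ 2 * b ^ 4 * c ^ 2
      + 576 * a * b ^ 5 * c + 64 * b ^ 6) := by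
  ring

theorem exists_addOrderOf_eq_nine_iff (hD : 4 * A ^ 3 + 27 * B ^ 2 ≠ 0) :
    (∃ P : (shortCurve A B).Point, addOrderOf P = 9) ↔ sigmaNine.HasIntegralSolution A B := by
  rw [hasIntegralSolution_sigmaNine]
  constructor
  · rintro ⟨P, hP⟩
    obtain ⟨x, y, h, rfl, hy⟩ := exists_eq_some_of_addOrderOf hP (by norm_num)
    have h9 : 3 • 3 • some x y h = 0 := by
      rw [← mul_nsmul]
      exact nsmul_eq_zero_of_addOrderOf_eq hP
    obtain ⟨x₀, y₀, h₀, h3⟩ := exists_eq_some (P := 3 • some x y h)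
      (nsmul_ne_zero_of_lt_addOrderOf three_ne_zero (by rw [hP]; norm_num))
    rw [h3] at h9
    obtain ⟨a, b, rfl, rfl, hA, hB⟩ := exists_of_addOrderOf_eq_three hD h9
    obtain ⟨n, rfl⟩ := exists_int_x hD (by norm_num) hP
    obtain ⟨c, rfl⟩ : ∃ c : ℤ, n = c + 3 * a ^ 2 := ⟨n - 3 * a ^ 2, by ring⟩
    obtain ⟨w, rfl⟩ : ∃ w : ℤ, b = w - 9 * a ^ 3 := ⟨b + 9 * a ^ 3, by ring⟩
    refine ⟨a, w, c, by rw [hA]; ring, by rw [hB]; ring, ?_⟩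
    have hc : (c : ℚ) ≠ 0 := by
      intro hc
      have h3P := nsmul_ne_zero_of_lt_addOrderOf three_ne_zero
        (show 3 < addOrderOf (some _ y h) by rw [hP]; norm_num)
      obtain h' | h' := (X_eq_iff (h₁ := h) (h₂ := h₀)).1 (by push_cast; rw [hc]; ring)
      · exact h3P (by rw [h', h9])
      · exact h3P (by rw [h', neg_nsmul, h9, _root_.neg_zero])
    obtain ⟨l, x₂, y₂, h₂, hl, hx₂, -, h2⟩ := exists_two_nsmul hD h hy
    obtain ⟨m, x₃, y₃, h₃, hm, hx₃, -, h3'⟩ := exists_add hD h (neg_nonsingular h₀) (by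
      push_cast
      intro h0
      exact hc (by linear_combination h0))
    obtain rfl : x₃ = x₂ := by
      have : some _ _ h₃ + some _ _ h₂ = 0 := by
        rw [← h3', ← h2, ← neg_some_eq h₀, ← h3]
        abel
      rw [add_eq_zero_iff_eq_neg, neg_some_eq, some.injEq] at this
      exact this.1
    have e := equation h
    rw [hA, hB] at e
    rw [hA] at hl
    push_cast at *
    have key := trisection_identity a w c
    -- The left side of the identity becomes `(8y³w)² - 64y⁶w² = 0`.
    rw [show ((c : ℚ) ^ 3 + (3 * a * c + w) ^ 2) = y ^ 2 by linear_combination -e,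
      show (3 * c ^ 2 + 18 * a ^ 2 * c + 6 * a * w : ℚ) = l * (2 * y) by linear_combination -hl,
      show (l * (2 * y)) ^ 2 * c ^ 2 - 4 * y ^ 2 * (y ^ 2 + c ^ 3 + w ^ 2) = 8 * y ^ 3 * w by
        linear_combination 4 * y ^ 2 * c ^ 2 * (hx₃ - hx₂)
         + 4 * y ^ 2 * (m * c + y + w) * hm] at key
    have := mul_left_cancel₀ (pow_ne_zero 3 hc) (key.symm.trans (show _ = (c : ℚ) ^ 3 * 0 by ring))
    exact_mod_cast this
  · rintro ⟨a, w, c, hA, hB, hR⟩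
    have hR' : (c ^ 9 - 72 * a * w * c ^ 7 - 48 * (9 * a ^ 3 + 2 * w) * w * c ^ 6
      - 864 * a ^ 2 * w ^ 2 * c ^ 5 - 144 * a * w ^ 3 * c ^ 4
      + 48 * (36 * a ^ 3 + w) * w ^ 3 * c ^ 3 + 1728 * a ^ 2 * w ^ 4 * c ^ 2
      + 576 * a * w ^ 5 * c + 64 * w ^ 6 : ℚ) = 0 := by exact_mod_cast hR
    have hA' : (A : ℚ) = 6 * a * w - 27 * a ^ 4 := by exact_mod_cast hA.symm
    have hB' : (B : ℚ) = w ^ 2 - 18 * a ^ 3 * w + 54 * a ^ 6 := by exact_mod_cast hB.symm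
    have hw : (w : ℚ) ≠ 0 := by
      intro hw
      rw [hw] at hA' hB'
      exact false_of_singular hD (e := 3 * a ^ 2) (by rw [hA']; ring) (by rw [hB']; ring)
    have hc : (c : ℚ) ≠ 0 := by
      intro hc
      rw [hc] at hR'
      exact hw (pow_eq_zero_iff (n := 6) (by norm_num) |>.1 (by linear_combination hR' / 64))
    have key := trisection_identity a w c
    rw [hR', mul_zero] at key
    obtain ⟨f, hf⟩ : ∃ f : ℚ, f = c ^ 3 + (3 * a * c + w) ^ 2 := ⟨_, rfl⟩
    obtain ⟨g, hg⟩ : ∃ g : ℚ, g = 3 * c ^ 2 + 18 * a ^ 2 * c + 6 * a * w := ⟨_, rfl⟩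
    rw [← hf, ← hg] at key
    -- If `f = 0`, then `key` makes the derivative `g` vanish too, and the cubic has a double root.
    have hf0 : f ≠ 0 := by
      rintro rfl
      have hg0 : g = 0 := by
        have : (g * c) ^ 4 = 0 := by linear_combination key
        simpa [hc] using this
      rw [hg0] at hg
      have hA'' : (A : ℚ) = -3 * (c + 3 * a ^ 2) ^ 2 := by linear_combination hA' - hg
      exact false_of_singular hD hA''
        (by linear_combination hB' - hf + (c + 3 * a ^ 2) * (hA' - hA''))
    -- Solving the relation before it was squared gives a rational `y` with the right sign; `key`
    -- then says `y² = f`.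
    obtain ⟨y, hy⟩ : ∃ y : ℚ, y * (8 * f * w) = g ^ 2 * c ^ 2 - 4 * f * (f + c ^ 3 + w ^ 2) :=
      ⟨_, div_mul_cancel₀ _ (mul_ne_zero (mul_ne_zero (by norm_num) hf0) hw)⟩
    have hyf : y ^ 2 = f := by
      apply mul_left_cancel₀ (pow_ne_zero 2 (mul_ne_zero hf0 hw))
      rw [← hy] at key
      linear_combination key / 64
    have hy0 : y ≠ 0 := by
      rintro rfl
      exact hf0 (by rw [← hyf]; ring)
    have h : (shortCurve A B).Nonsingular (c + 3 * a ^ 2) y :=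
      shortCurve_nonsingular hD (by rw [hyf, hf, hA', hB']; ring)
    have h₀ : (shortCurve A B).Nonsingular (3 * a ^ 2) w :=
      shortCurve_nonsingular hD (by rw [hA', hB']; ring)
    have hT := three_nsmul_eq_zero hD (a := a) (b := w - 9 * a ^ 3) (by rw [← hA]; ring)
      (by rw [← hB]; ring) h₀ rfl (by push_cast; ring)
    obtain ⟨l, x₂, y₂, h₂, hl, hx₂, -, h2⟩ := exists_two_nsmul hD h hy0
    obtain ⟨m, x₃, y₃, h₃, hm, hx₃, -, h3⟩ := exists_add hD h (neg_nonsingular h₀)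
      (by simpa using hc)
    have hlg : l * (2 * y) = g := by
      rw [hl, hg, hA']
      ring
    have hm' : m * c = y + w := by linear_combination hm
    obtain rfl : x₃ = x₂ := by
      apply mul_left_cancel₀ (pow_ne_zero 2 (mul_ne_zero (mul_ne_zero two_ne_zero hy0) hc))
      rw [← hlg, ← hyf] at hy
      rw [hx₂, hx₃]
      linear_combination hy + 4 * y ^ 2 * (m * c + y + w) * hm'
    have h3T : 3 • some _ y h = some _ _ h₀ := by
      -- Equal abscissas mean `2P = P - T`, impossible as `c ≠ 0`, or `3P = T`.
      obtain h' | h' := eq_or_add_eq_zero h₂ h₃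
      · rw [← h2, ← h3, ← neg_some_eq h₀, two_nsmul, add_right_inj, neg_some_eq, some.injEq] at h'
        exact absurd (by linear_combination h'.1) hc
      · rw [← h2, ← h3, ← neg_some_eq h₀] at h'
        rw [← sub_eq_zero, ← h']
        abel
    refine ⟨some _ y h, addOrderOf_eq_prime_pow (p := 3) (n := 1) ?_ ?_⟩
    · rw [pow_one, h3T]
      exact some_ne_zero _
    · rw [show 3 ^ (1 + 1) = 3 * 3 from rfl, mul_nsmul, h3T, hT]

end shortCurve

/-! ### Weighted homogeneity -/

namespace TorsionSystem

open MvPolynomial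

/-- The summands get independent degrees, found by unification and compared only afterwards. -/
theorem isWeightedHomogeneous_add_of_eq {σ R : Type*} [CommSemiring R] {w : σ → ℕ}
    {p q : MvPolynomial σ R} {m n : ℕ} (hp : IsWeightedHomogeneous w p m)
    (hq : IsWeightedHomogeneous w q n) (h : n = m) : IsWeightedHomogeneous w (p + q) m :=
  hp.add (h ▸ hq)

theorem isWeightedHomogeneous_neg {σ R : Type*} [CommRing R] {w : σ → ℕ}
    {p : MvPolynomial σ R} {m : ℕ} (hp : IsWeightedHomogeneous w p m) :
    IsWeightedHomogeneous w (-p) m :=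
  (weightedHomogeneousSubmodule R w m).neg_mem hp

theorem isWeightedHomogeneous_sub_of_eq {σ R : Type*} [CommRing R] {w : σ → ℕ}
    {p q : MvPolynomial σ R} {m n : ℕ} (hp : IsWeightedHomogeneous w p m)
    (hq : IsWeightedHomogeneous w q n) (h : n = m) : IsWeightedHomogeneous w (p - q) m :=
  (weightedHomogeneousSubmodule R w m).sub_mem hp (h ▸ hq)

theorem isWeightedHomogeneous_ofNat {σ R : Type*} [CommSemiring R] {w : σ → ℕ} (n : ℕ)
    [n.AtLeastTwo] : IsWeightedHomogeneous w (ofNat(n) : MvPolynomial σ R) 0 :=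
  isWeightedHomogeneous_C w (ofNat(n) : R)

theorem isQuasiHomogeneous_all : sigmaTwoOne.IsQuasiHomogeneous ∧
    sigmaTwoThree.IsQuasiHomogeneous ∧ sigmaThree.IsQuasiHomogeneous ∧
    sigmaFour.IsQuasiHomogeneous ∧ sigmaFive.IsQuasiHomogeneous ∧
    sigmaSeven.IsQuasiHomogeneous ∧ sigmaEight.IsQuasiHomogeneous ∧
    sigmaNine.IsQuasiHomogeneous := by
  -- Slopes weigh 1, abscissas 2, ordinates 3; for order two all weights are halved. Absent
  -- variables get weight 1.
  refine ⟨⟨![2, 1, 1, 1], by decide, ?_⟩, ⟨![1, 1, 1, 1], by decide, ?_⟩,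
    ⟨![1, 3, 1, 1], by decide, ?_⟩, ⟨![2, 1, 1, 1], by decide, ?_⟩, ⟨![2, 2, 1, 1], by decide, ?_⟩,
    ⟨![2, 2, 1, 2], by decide, ?_⟩, ⟨![1, 1, 1, 1], by decide, ?_⟩, ⟨![1, 3, 2, 1], by decide, ?_⟩⟩
  all_goals
    dsimp only [sigmaTwoOne, sigmaTwoThree, sigmaThree, sigmaFour, sigmaFive, sigmaSeven,
      sigmaEight, sigmaNine]
    refine ⟨?_, ?_, ?_, ?_⟩
  all_goals apply Exists.intro
  repeat with_reducible_and_instances first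
    | exact isWeightedHomogeneous_zero _ _ 0
    | apply isWeightedHomogeneous_add_of_eq
    | apply isWeightedHomogeneous_sub_of_eq
    | apply isWeightedHomogeneous_neg
    | apply IsWeightedHomogeneous.mul
    | apply IsWeightedHomogeneous.pow
    | apply isWeightedHomogeneous_X
    | apply isWeightedHomogeneous_ofNat
    | decide

end TorsionSystem

open TorsionSystem shortCurve in
theorem mainTheorem1 :
    ((∀ n ∈ ({3, 4, 5, 7, 8, 9} : Finset ℕ), (TorsionSystem.sigma n).IsQuasiHomogeneous) ∧
      TorsionSystem.sigmaTwoOne.IsQuasiHomogeneous ∧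
      TorsionSystem.sigmaTwoThree.IsQuasiHomogeneous) ∧
    ∀ A B : ℤ, 4 * A ^ 3 + 27 * B ^ 2 ≠ 0 →
      (∀ n ∈ ({3, 4, 5, 7, 8, 9} : Finset ℕ),
        (∃ P : (shortCurve A B).Point, addOrderOf P = n) ↔
          (TorsionSystem.sigma n).HasIntegralSolution A B) ∧
      ((∃ P : (shortCurve A B).Point, addOrderOf P = 2) ↔
        TorsionSystem.sigmaTwoOne.HasIntegralSolution A B) ∧
      ({P : (shortCurve A B).Point | addOrderOf P = 2}.encard = 3 ↔
        TorsionSystem.sigmaTwoThree.HasIntegralSolution A B) := by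
  obtain ⟨q₁, q₂, q₃, q₄, q₅, q₇, q₈, q₉⟩ := isQuasiHomogeneous_all
  refine ⟨⟨?_, q₁, q₂⟩, fun A B hD ↦ ⟨?_, exists_addOrderOf_eq_two_iff hD,
    encard_addOrderOf_eq_two_iff hD⟩⟩ <;> intro n hn <;>
    simp only [Finset.mem_insert, Finset.mem_singleton] at hn
  · rcases hn with rfl | rfl | rfl | rfl | rfl | rfl
    exacts [q₃, q₄, q₅, q₇, q₈, q₉]
  · rcases hn with rfl | rfl | rfl | rfl | rfl | rfl
    exacts [exists_addOrderOf_eq_three_iff hD, exists_addOrderOf_eq_four_iff hD,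
      exists_addOrderOf_eq_five_iff hD, exists_addOrderOf_eq_seven_iff hD,
      exists_addOrderOf_eq_eight_iff hD, exists_addOrderOf_eq_nine_iff hD]
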